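/- Let $\mathbb F$ be a field and let $L$ and $H$ be $5$-dimensional nilpotent Lie algebras over $\mathbb F$, with universal enveloping algebras $U(L)$ and $U(H)$. Then $U(L)\cong U(H)$ as associative $\mathbb F$-algebras if and only if one of the following holds: (i) $L\cong H$ as Lie algebras over $\mathbb F$; (ii) $\operatorname{char}\mathbb F=2$ and, up to interchanging $L$ and $H$, either $L\cong L_{5,3}$ and $H\cong L_{5,5}$, or $L\cong L_{5,6}$ and $H\cong L_{5,7}$. Here each $L_{5,k}$ is the Lie algebra over $\mathbb F$ with basis $x_1,\dots,x_5$ and the following brackets, all other brackets $[x_i,x_j]$ with $i<j$ being zero: - $L_{5,3}$: $[x_1,x_2]=x_3,\ [x_1,x_3]=x_4$; - $L_{5,5}$: $[x_1,x_2]=x_3,\ [x_1,x_3]=x_5,\ [x_2,x_4]=x_5$; - $L_{5,6}$: $[x_1,x_2]=x_3,\ [x_1,x_3]=x_4,\ [x_1,x_4]=x_5,\ [x_2,x_3]=x_5$; - $L_{5,7}$: $[x_1,x_2]=x_3,\ [x_1,x_3]=x_4,\ [x_1,x_4]=x_5$. -/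

import Mathlib

/-- The names of four of the five-dimensional nilpotent Lie algebras in de Graaf's classification:
`L_{5,3}`, `L_{5,5}`, `L_{5,6}` and `L_{5,7}`. -/
inductive DeGraafName
  | L53
  | L55
  | L56
  | L57

/-- The underlying vector space of the Lie algebra with the given name: coordinate vectors with
respect to a basis `x₁, …, x₅`, where `x₁, …, x₅` correspond to the indices `0, …, 4`. -/
def DeGraafLie (_ : DeGraafName) (F : Type*) : Type _ := Fin 5 → F

namespace DeGraafLie

instance (k : DeGraafName) (F : Type*) [Field F] : AddCommGroup (DeGraafLie k F) :=
  inferInstanceAs (AddCommGroup (Fin 5 → F))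

instance (k : DeGraafName) (F : Type*) [Field F] : Module F (DeGraafLie k F) :=
  inferInstanceAs (Module F (Fin 5 → F))

/-- The Lie brackets in coordinates. On basis vectors they are given by the following tables, where
the `[xᵢ,xⱼ]` with `i < j` that are not listed are zero:
* `L_{5,3}`: `[x₁,x₂] = x₃, [x₁,x₃] = x₄`;
* `L_{5,5}`: `[x₁,x₂] = x₃, [x₁,x₃] = x₅, [x₂,x₄] = x₅`;
* `L_{5,6}`: `[x₁,x₂] = x₃, [x₁,x₃] = x₄, [x₁,x₄] = x₅, [x₂,x₃] = x₅`;
* `L_{5,7}`: `[x₁,x₂] = x₃, [x₁,x₃] = x₄, [x₁,x₄] = x₅`. -/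
def bracket {F : Type*} [Field F] (k : DeGraafName) (x y : Fin 5 → F) : Fin 5 → F :=
  match k with
  | .L53 => ![0, 0, x 0 * y 1 - x 1 * y 0, x 0 * y 2 - x 2 * y 0, 0]
  | .L55 => ![0, 0, x 0 * y 1 - x 1 * y 0, 0, (x 0 * y 2 - x 2 * y 0) + (x 1 * y 3 - x 3 * y 1)]
  | .L56 => ![0, 0, x 0 * y 1 - x 1 * y 0, x 0 * y 2 - x 2 * y 0,
      (x 0 * y 3 - x 3 * y 0) + (x 1 * y 2 - x 2 * y 1)]
  | .L57 => ![0, 0, x 0 * y 1 - x 1 * y 0, x 0 * y 2 - x 2 * y 0, x 0 * y 3 - x 3 * y 0]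

section

variable {F : Type*} [Field F] (k : DeGraafName)

theorem bracket_add_left (x y z : Fin 5 → F) :
    bracket k (x + y) z = bracket k x z + bracket k y z := by
  cases k <;> ext i <;> fin_cases i <;> simp [bracket] <;> ring

theorem bracket_add_right (x y z : Fin 5 → F) :
    bracket k x (y + z) = bracket k x y + bracket k x z := by
  cases k <;> ext i <;> fin_cases i <;> simp [bracket] <;> ring

theorem bracket_self (x : Fin 5 → F) : bracket k x x = 0 := by
  cases k <;> ext i <;> fin_cases i <;> simp [bracket] <;> ring

theorem bracket_leibniz (x y z : Fin 5 → F) :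
    bracket k x (bracket k y z) = bracket k (bracket k x y) z + bracket k y (bracket k x z) := by
  cases k <;> ext i <;> fin_cases i <;> simp [bracket] <;> ring

theorem bracket_smul_right (t : F) (x y : Fin 5 → F) :
    bracket k x (t • y) = t • bracket k x y := by
  cases k <;> ext i <;> fin_cases i <;> simp [bracket] <;> ring

end

instance (k : DeGraafName) (F : Type*) [Field F] : LieRing (DeGraafLie k F) where
  bracket x y := bracket k x y
  add_lie := bracket_add_left k
  lie_add := bracket_add_right k
  lie_self := bracket_self k
  leibniz_lie := bracket_leibniz k

instance (k : DeGraafName) (F : Type*) [Field F] : LieAlgebra F (DeGraafLie k F) where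
  lie_smul := bracket_smul_right k

end DeGraafLie

/-! The proof confronts a classification of the five-dimensional nilpotent Lie algebras with the
filtration of the enveloping algebra by the powers of its augmentation ideal ω. An isomorphism of
enveloping algebras can be composed with an automorphism so that it respects augmentations
(`exists_augmented_equiv`); it then preserves every ω^k. Since ω/ω² is L/[L,L], the number d of
generators is an invariant (`finrank_quotient_derivedSubmodule_le`).

By `classification`, d is 5 (abelian), 4 (two algebras of Heisenberg type), 3 (`L_{5,8}`, `L_{5,3}`,
`L_{5,5}`) or 2 (`L_{5,9}`, `L_{5,7}`, `L_{5,6}`). For equal d the types are separated as follows.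
The nilpotency class shows in how deep iterated commutators of elements of ω lie. The two Heisenberg
types, and likewise `L_{5,3}` and `L_{5,5}`, differ in that only one of the two has a central
element outside the derived algebra; its image is x + r with r in ω², and the commutators [r, y] are
too small to cancel [x, y]. In `L_{5,7}` there are generators with [Y,[X,Y]] = 0, and
`lie_lie_ne_zero_of_filiformType` excludes them for `L_{5,6}`. That an element is not in some ω^k is
always read off from an entry of a nilpotent matrix representation, which takes the place of a
Poincaré–Birkhoff–Witt basis.

The last two separations, `L_{5,3}` from `L_{5,5}` and `L_{5,7}` from `L_{5,6}`, need 2 ≠ 0: the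
functionals behave like coefficients with respect to symmetrized monomials, and contain halves. In
characteristic two, ad(x²) = ad(x)², so a square can imitate the bracket that distinguishes the two
algebras, and replacing one generator y by y + x₁² is an isomorphism of enveloping algebras. -/

namespace UniversalEnvelopingAlgebra

/-! ### The augmentation ideal and its powers. -/

section Basic

attribute [local instance] LieRing.ofAssociativeRing

variable {F L A : Type*} [Field F] [LieRing L] [LieAlgebra F L] [Ring A] [Algebra F A]

/-- The canonical map into the universal enveloping algebra as a linear map. -/
def incl (F : Type*) {L : Type*} [Field F] [LieRing L] [LieAlgebra F L] :
    L →ₗ[F] UniversalEnvelopingAlgebra F L :=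
  (ι F : L →ₗ⁅F⁆ UniversalEnvelopingAlgebra F L)

theorem incl_lie (x y : L) : incl F ⁅x, y⁆ = incl F x * incl F y - incl F y * incl F x := by
  change ι F ⁅x, y⁆ = ι F x * ι F y - ι F y * ι F x
  rw [LieHom.map_lie, LieRing.of_associative_ring_bracket]

/-- The algebra homomorphism extending a linear map that turns brackets into commutators. -/
def liftLinear (g : L →ₗ[F] A) (hg : ∀ x y, g ⁅x, y⁆ = g x * g y - g y * g x) :
    UniversalEnvelopingAlgebra F L →ₐ[F] A :=
  lift F { g with map_lie' := fun {x y} => hg x y }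

@[simp]
theorem liftLinear_incl (g : L →ₗ[F] A) (hg : ∀ x y, g ⁅x, y⁆ = g x * g y - g y * g x) (x : L) :
    liftLinear g hg (incl F x) = g x :=
  lift_ι_apply F _ x

theorem algHom_ext_incl {f g : UniversalEnvelopingAlgebra F L →ₐ[F] A}
    (h : ∀ x, f (incl F x) = g (incl F x)) : f = g :=
  hom_ext F (LieHom.ext h)

theorem adjoin_range_incl :
    Algebra.adjoin F (Set.range (incl F : L → UniversalEnvelopingAlgebra F L)) = ⊤ := by
  set S := Algebra.adjoin F (Set.range (incl F : L → UniversalEnvelopingAlgebra F L)) with hS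
  have hmem : ∀ x, incl F x ∈ S.toSubmodule := fun x => Algebra.subset_adjoin ⟨x, rfl⟩
  let g : L →ₗ[F] S := (incl F).codRestrict S.toSubmodule hmem
  have hg : ∀ x y, g ⁅x, y⁆ = g x * g y - g y * g x := fun x y => Subtype.ext (incl_lie x y)
  have h : S.val.comp (liftLinear g hg) = AlgHom.id F _ := algHom_ext_incl fun x => by
    simp only [AlgHom.comp_apply, liftLinear_incl]; rfl
  refine eq_top_iff.2 fun u _ => ?_
  have := DFunLike.congr_fun h u
  rw [AlgHom.id_apply] at this
  rw [← this]
  exact (liftLinear g hg u).2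

/-- The augmentation of the universal enveloping algebra. -/
def augmentation (F L : Type*) [Field F] [LieRing L] [LieAlgebra F L] :
    UniversalEnvelopingAlgebra F L →ₐ[F] F :=
  liftLinear 0 (by simp)

@[simp]
theorem augmentation_incl (x : L) : augmentation F L (incl F x) = 0 := by
  simp [augmentation]

/-- The augmentation ideal of the universal enveloping algebra, as a subspace. -/
def augIdeal (F L : Type*) [Field F] [LieRing L] [LieAlgebra F L] :
    Submodule F (UniversalEnvelopingAlgebra F L) :=
  LinearMap.ker (augmentation F L).toLinearMap

theorem mem_augIdeal {u : UniversalEnvelopingAlgebra F L} :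
    u ∈ augIdeal F L ↔ augmentation F L u = 0 := Iff.rfl

theorem incl_mem_augIdeal (x : L) : incl F x ∈ augIdeal F L := augmentation_incl x

/-- An algebra homomorphism maps the augmentation ideal into every multiplicatively closed subspace
that contains the image of the Lie algebra. -/
theorem apply_mem_of_mem_augIdeal (f : UniversalEnvelopingAlgebra F L →ₐ[F] A)
    (J : Submodule F A) (hJ : J * J ≤ J) (h : ∀ x, f (incl F x) ∈ J)
    {u : UniversalEnvelopingAlgebra F L} (hu : u ∈ augIdeal F L) : f u ∈ J := by
  -- The induction runs over all of the enveloping algebra, so the claim is extended to every `u` by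
  -- subtracting its augmentation.
  have key : ∀ u, f u - algebraMap F A (augmentation F L u) ∈ J := fun u => by
    have hu : u ∈ Algebra.adjoin F (Set.range (incl F : L → UniversalEnvelopingAlgebra F L)) := by
      rw [adjoin_range_incl]; trivial
    induction hu using Algebra.adjoin_induction with
    | mem x hx => obtain ⟨y, rfl⟩ := hx; simpa using h y
    | algebraMap r => simp
    | add x y _ _ hx hy =>
      have := J.add_mem hx hy
      rw [map_add, map_add, map_add]
      convert this using 1
      abel
    | mul x y _ _ hx hy =>
      set a := augmentation F L x with ha
      set b := augmentation F L y with hb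
      have e : f (x * y) - algebraMap F A (augmentation F L (x * y)) =
          (f x - algebraMap F A a) * (f y - algebraMap F A b) + b • (f x - algebraMap F A a) +
            a • (f y - algebraMap F A b) := by
        rw [map_mul, map_mul, ← ha, ← hb, map_mul, Algebra.smul_def, Algebra.smul_def,
          Algebra.commutes b (f x - _)]
        noncomm_ring
      rw [e]
      exact J.add_mem (J.add_mem (hJ (Submodule.mul_mem_mul hx hy)) (J.smul_mem _ hx))
        (J.smul_mem _ hy)
  have := key u
  rwa [mem_augIdeal.1 hu, map_zero, sub_zero] at this

theorem augIdeal_mul_self_le : augIdeal F L * augIdeal F L ≤ augIdeal F L := by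
  rw [Submodule.mul_le]
  intro a ha b _
  rw [mem_augIdeal] at *
  rw [map_mul, ha, zero_mul]

theorem augIdeal_pow_le {m n : ℕ} (hm : 1 ≤ m) (hmn : m ≤ n) :
    augIdeal F L ^ n ≤ augIdeal F L ^ m := by
  induction n, hmn using Nat.le_induction with
  | base => exact le_rfl
  | succ n hn ih =>
    refine le_trans ?_ ih
    obtain ⟨k, rfl⟩ := Nat.exists_eq_succ_of_ne_zero (by omega : n ≠ 0)
    rw [Nat.succ_eq_add_one, pow_succ, pow_succ, mul_assoc]
    exact mul_le_mul' le_rfl augIdeal_mul_self_le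

/-- The sum L + ω² is closed under products and contains L, hence contains ω. This makes ω^k
computable modulo ω^(k+1) from products of k elements of L. -/
theorem augIdeal_eq : augIdeal F L = LinearMap.range (incl F) ⊔ augIdeal F L ^ 2 := by
  have hle : LinearMap.range (incl F) ≤ augIdeal F L := by
    rintro _ ⟨x, rfl⟩; exact incl_mem_augIdeal x
  have hle2 : augIdeal F L ^ 2 ≤ augIdeal F L := by
    rw [pow_two]; exact augIdeal_mul_self_le
  refine le_antisymm (fun u hu => ?_) (sup_le hle hle2)
  refine apply_mem_of_mem_augIdeal (AlgHom.id F _)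
    (LinearMap.range (incl F) ⊔ augIdeal F L ^ 2) ?_ (fun x => ?_) hu
  · calc _ ≤ augIdeal F L * augIdeal F L :=
          mul_le_mul' (sup_le hle hle2) (sup_le hle hle2)
      _ ≤ _ := by rw [← pow_two]; exact le_sup_right
  · exact Submodule.mem_sup_left ⟨x, rfl⟩

theorem lie_mem_augIdeal_pow {i j : ℕ} {a b : UniversalEnvelopingAlgebra F L}
    (ha : a ∈ augIdeal F L ^ i) (hb : b ∈ augIdeal F L ^ j) :
    ⁅a, b⁆ ∈ augIdeal F L ^ (i + j) := by
  rw [LieRing.of_associative_ring_bracket]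
  refine Submodule.sub_mem _ ?_ ?_
  · rw [pow_add]; exact Submodule.mul_mem_mul ha hb
  · rw [add_comm, pow_add]; exact Submodule.mul_mem_mul hb ha

theorem map_augIdeal_pow {L' : Type*} [LieRing L'] [LieAlgebra F L']
    (φ : UniversalEnvelopingAlgebra F L ≃ₐ[F] UniversalEnvelopingAlgebra F L')
    (h : ∀ u, augmentation F L' (φ u) = augmentation F L u) (n : ℕ) :
    (augIdeal F L ^ n).map φ.toLinearMap = augIdeal F L' ^ n := by
  have h1 : (augIdeal F L).map φ.toLinearMap = augIdeal F L' := by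
    ext u
    constructor
    · rintro ⟨v, hv, rfl⟩
      exact (h v).trans hv
    · intro hu
      refine ⟨φ.symm u, ?_, φ.apply_symm_apply u⟩
      change augmentation F L (φ.symm u) = 0
      rw [← h, φ.apply_symm_apply]; exact hu
  rw [← h1]
  exact Submodule.map_pow (augIdeal F L) φ.toAlgHom n

/-- An isomorphism of enveloping algebras can be made to respect the augmentations. -/
theorem exists_augmented_equiv {L' : Type*} [LieRing L'] [LieAlgebra F L']
    (φ : UniversalEnvelopingAlgebra F L ≃ₐ[F] UniversalEnvelopingAlgebra F L') :
    ∃ ψ : UniversalEnvelopingAlgebra F L ≃ₐ[F] UniversalEnvelopingAlgebra F L',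
      ∀ u, augmentation F L' (ψ u) = augmentation F L u := by
  let lam : L →ₗ[F] F := (augmentation F L').toLinearMap ∘ₗ φ.toLinearMap ∘ₗ incl F
  have hlam : ∀ x y : L, lam ⁅x, y⁆ = 0 := fun x y => by
    change augmentation F L' (φ (incl F ⁅x, y⁆)) = 0
    rw [incl_lie, map_sub, map_mul, map_mul, map_sub, map_mul, map_mul, mul_comm, sub_self]
  -- The character `lam` measures the failure of `φ` to respect augmentations. It kills brackets, so
  -- each shift x ↦ x + c·lam(x) extends to the enveloping algebra; the shifts by `c` and `-c` are
  -- inverse, and the one with `c = -1` repairs `φ`.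
  let g (c : F) : L →ₗ[F] UniversalEnvelopingAlgebra F L :=
    incl F + c • (Algebra.linearMap F _ ∘ₗ lam)
  have hgx : ∀ c x, g c x = incl F x + c • algebraMap F _ (lam x) := fun _ _ => rfl
  have hg : ∀ c x y, g c ⁅x, y⁆ = g c x * g c y - g c y * g c x := fun c x y => by
    simp only [hgx, hlam, incl_lie, map_zero, smul_zero, add_zero, mul_add, add_mul,
      mul_smul_comm, smul_mul_assoc, smul_add, ← map_mul, mul_comm (lam y) (lam x), Algebra.commutes]
    abel
  have hcomp : ∀ c d x, c + d = 0 → liftLinear (g c) (hg c) (liftLinear (g d) (hg d) (incl F x)) =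
      incl F x := fun c d x hcd => by
    rw [liftLinear_incl, hgx, map_add, map_smul, liftLinear_incl, AlgHom.commutes, hgx, add_assoc,
      ← add_smul, hcd, zero_smul, add_zero]
  let τ : UniversalEnvelopingAlgebra F L ≃ₐ[F] UniversalEnvelopingAlgebra F L :=
    AlgEquiv.ofAlgHom (liftLinear (g (-1)) (hg _)) (liftLinear (g 1) (hg _))
      (algHom_ext_incl fun x => hcomp _ _ x (by ring))
      (algHom_ext_incl fun x => hcomp _ _ x (by ring))
  refine ⟨τ.trans φ, fun u => ?_⟩
  refine DFunLike.congr_fun (f := (augmentation F L').comp (τ.trans φ).toAlgHom) ?_ u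
  refine algHom_ext_incl fun x => ?_
  change augmentation F L' (φ (liftLinear (g (-1)) (hg _) (incl F x))) = _
  rw [liftLinear_incl, hgx, map_add, map_smul, map_add, map_smul, AlgEquiv.commutes,
    AlgHom.commutes, augmentation_incl]
  change lam x + (-1 : F) • lam x = 0
  simp

/-- Isomorphic Lie algebras have isomorphic enveloping algebras. -/
theorem nonempty_algEquiv_of_lieEquiv {L' : Type*} [LieRing L'] [LieAlgebra F L']
    (e : L ≃ₗ⁅F⁆ L') :
    Nonempty (UniversalEnvelopingAlgebra F L ≃ₐ[F] UniversalEnvelopingAlgebra F L') := by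
  have h1 : ∀ x y : L, (incl F ∘ₗ e.toLinearEquiv.toLinearMap) ⁅x, y⁆ =
      incl F (e x) * incl F (e y) - incl F (e y) * incl F (e x) := fun x y =>
    (congrArg (incl F) (e.map_lie x y)).trans (incl_lie _ _)
  have h2 : ∀ x y : L', (incl F ∘ₗ e.symm.toLinearEquiv.toLinearMap) ⁅x, y⁆ =
      incl F (e.symm x) * incl F (e.symm y) - incl F (e.symm y) * incl F (e.symm x) := fun x y =>
    (congrArg (incl F) (e.symm.map_lie x y)).trans (incl_lie _ _)
  have h3 : ∀ x, liftLinear _ h1 (incl F x) = incl F (e x) := liftLinear_incl _ h1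
  have h4 : ∀ x, liftLinear _ h2 (incl F x) = incl F (e.symm x) := liftLinear_incl _ h2
  refine ⟨AlgEquiv.ofAlgHom (liftLinear _ h1) (liftLinear _ h2)
    (algHom_ext_incl fun x => ?_) (algHom_ext_incl fun x => ?_)⟩
  · rw [AlgHom.comp_apply, h4, h3, e.apply_symm_apply, AlgHom.id_apply]
  · rw [AlgHom.comp_apply, h3, h4, e.symm_apply_apply, AlgHom.id_apply]

end Basic
end UniversalEnvelopingAlgebra

/-! ### Bracket tables and normal forms. -/

/-- A linear map between Lie algebras is compatible with brackets as soon as it is so on the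
increasing pairs of vectors of an ordered basis. -/
theorem LinearMap.map_lie_of_basis {F L M ι : Type*} [Field F] [LieRing L] [LieAlgebra F L]
    [LieRing M] [LieAlgebra F M] [LinearOrder ι] (b : Module.Basis ι F L) (g : L →ₗ[F] M)
    (h : ∀ i j, i < j → g ⁅b i, b j⁆ = ⁅g (b i), g (b j)⁆) (x y : L) :
    g ⁅x, y⁆ = ⁅g x, g y⁆ := by
  have hb : ∀ i j, g ⁅b i, b j⁆ = ⁅g (b i), g (b j)⁆ := fun i j => by
    rcases lt_trichotomy i j with hij | rfl | hij
    · exact h i j hij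
    · rw [lie_self, lie_self, map_zero]
    · rw [← lie_skew, ← lie_skew (g (b i)), map_neg, h j i hij]
  have hx : ∀ i, g ⁅x, b i⁆ = ⁅g x, g (b i)⁆ := fun i => by
    induction b.mem_span x using Submodule.span_induction with
    | zero => simp
    | add x y _ _ hx hy => rw [add_lie, map_add, map_add, add_lie, hx, hy]
    | smul a x _ hx => rw [smul_lie, map_smul, map_smul, smul_lie, hx]
    | mem x hx => obtain ⟨j, rfl⟩ := hx; exact hb j i
  induction b.mem_span y using Submodule.span_induction with
  | zero => simp
  | add y z _ _ hy hz => rw [lie_add, map_add, map_add, lie_add, hy, hz]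
  | smul a y _ hy => rw [lie_smul, map_smul, map_smul, lie_smul, hy]
  | mem y hy => obtain ⟨j, rfl⟩ := hy; exact hx j

/-- The brackets `⁅b i, b j⁆`, `i < j`, of a family of five vectors. -/
structure HasBrackets {L : Type*} [LieRing L] (b : Fin 5 → L)
    (c01 c02 c03 c04 c12 c13 c14 c23 c24 c34 : L) : Prop where
  h01 : ⁅b 0, b 1⁆ = c01
  h02 : ⁅b 0, b 2⁆ = c02
  h03 : ⁅b 0, b 3⁆ = c03
  h04 : ⁅b 0, b 4⁆ = c04
  h12 : ⁅b 1, b 2⁆ = c12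
  h13 : ⁅b 1, b 3⁆ = c13
  h14 : ⁅b 1, b 4⁆ = c14
  h23 : ⁅b 2, b 3⁆ = c23
  h24 : ⁅b 2, b 4⁆ = c24
  h34 : ⁅b 3, b 4⁆ = c34

theorem HasBrackets.map_lie {F L M : Type*} [Field F] [LieRing L] [LieAlgebra F L]
    [LieRing M] [LieAlgebra F M] {b : Module.Basis (Fin 5) F L}
    {c01 c02 c03 c04 c12 c13 c14 c23 c24 c34 : L}
    (h : HasBrackets b c01 c02 c03 c04 c12 c13 c14 c23 c24 c34) (g : L →ₗ[F] M)
    (h' : HasBrackets (fun i => g (b i)) (g c01) (g c02) (g c03) (g c04) (g c12) (g c13) (g c14)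
      (g c23) (g c24) (g c34)) (x y : L) :
    g ⁅x, y⁆ = ⁅g x, g y⁆ := by
  refine LinearMap.map_lie_of_basis b g (fun i j hij => ?_) x y
  obtain ⟨h01, h02, h03, h04, h12, h13, h14, h23, h24, h34⟩ := h
  obtain ⟨h01', h02', h03', h04', h12', h13', h14', h23', h24', h34'⟩ := h'
  fin_cases i <;> fin_cases j <;> first | exact absurd hij (by decide) | skip
  · exact (congrArg g h01).trans h01'.symm
  · exact (congrArg g h02).trans h02'.symm
  · exact (congrArg g h03).trans h03'.symm
  · exact (congrArg g h04).trans h04'.symm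
  · exact (congrArg g h12).trans h12'.symm
  · exact (congrArg g h13).trans h13'.symm
  · exact (congrArg g h14).trans h14'.symm
  · exact (congrArg g h23).trans h23'.symm
  · exact (congrArg g h24).trans h24'.symm
  · exact (congrArg g h34).trans h34'.symm

/-- Bases with the same brackets give an isomorphism of Lie algebras. -/
theorem HasBrackets.nonempty_lieEquiv {F L M : Type*} [Field F] [LieRing L] [LieAlgebra F L]
    [LieRing M] [LieAlgebra F M] {b : Module.Basis (Fin 5) F L} {b' : Module.Basis (Fin 5) F M}
    {c01 c02 c03 c04 c12 c13 c14 c23 c24 c34 : L}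
    {c01' c02' c03' c04' c12' c13' c14' c23' c24' c34' : M}
    (h : HasBrackets b c01 c02 c03 c04 c12 c13 c14 c23 c24 c34)
    (h' : HasBrackets b' c01' c02' c03' c04' c12' c13' c14' c23' c24' c34')
    (hc : let e := b.equiv b' (Equiv.refl _)
      e c01 = c01' ∧ e c02 = c02' ∧ e c03 = c03' ∧ e c04 = c04' ∧ e c12 = c12' ∧ e c13 = c13' ∧
        e c14 = c14' ∧ e c23 = c23' ∧ e c24 = c24' ∧ e c34 = c34') :
    Nonempty (L ≃ₗ⁅F⁆ M) := by
  have key : ∀ x y, b.equiv b' (Equiv.refl _) ⁅x, y⁆ =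
      ⁅b.equiv b' (Equiv.refl _) x, b.equiv b' (Equiv.refl _) y⁆ := by
    refine h.map_lie (b.equiv b' (Equiv.refl _)).toLinearMap ?_
    obtain ⟨h01, h02, h03, h04, h12, h13, h14, h23, h24, h34⟩ := hc
    simp only [LinearEquiv.coe_coe, h01, h02, h03, h04, h12, h13, h14, h23, h24, h34,
      Module.Basis.equiv_apply, Equiv.refl_apply]
    exact h'
  exact ⟨{ b.equiv b' (Equiv.refl _) with map_lie' := fun {x y} => key x y }⟩

section Families

variable (F : Type*) [Field F] (L : Type*) [LieRing L] [LieAlgebra F L]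

/-- Five-dimensional algebras of the form Heisenberg algebra plus a central plane (`ε = 0`), or
the five-dimensional Heisenberg algebra (`ε = 1`). -/
def IsHeisenbergType (ε : F) : Prop :=
  ∃ b : Module.Basis (Fin 5) F L, HasBrackets b (b 4) 0 0 0 0 0 0 (ε • b 4) 0 0

/-- The algebra `L_{5,8}`. -/
def IsTwoStepType : Prop :=
  ∃ b : Module.Basis (Fin 5) F L, HasBrackets b (b 3) (b 4) 0 0 0 0 0 0 0 0

/-- The algebras `L_{5,3}` (`ε = 0`) and `L_{5,5}` (`ε = 1`). -/
def IsThreeStepType (ε : F) : Prop :=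
  ∃ b : Module.Basis (Fin 5) F L, HasBrackets b (b 2) (b 4) 0 0 0 (ε • b 4) 0 0 0 0

/-- The algebra `L_{5,9}`. -/
def IsFreeThreeStepType : Prop :=
  ∃ b : Module.Basis (Fin 5) F L, HasBrackets b (b 2) (b 3) 0 0 (b 4) 0 0 0 0 0

/-- The algebras `L_{5,7}` (`ε = 0`) and `L_{5,6}` (`ε = 1`). -/
def IsFiliformType (ε : F) : Prop :=
  ∃ b : Module.Basis (Fin 5) F L, HasBrackets b (b 2) (b 3) (b 4) 0 (ε • b 4) 0 0 0 0 0

variable {F L} {H : Type*} [LieRing H] [LieAlgebra F H]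

theorem IsHeisenbergType.lieEquiv {ε : F} (h : IsHeisenbergType F L ε)
    (h' : IsHeisenbergType F H ε) : Nonempty (L ≃ₗ⁅F⁆ H) := by
  obtain ⟨b, hb⟩ := h
  obtain ⟨b', hb'⟩ := h'
  exact hb.nonempty_lieEquiv hb' (by simp)

theorem IsTwoStepType.lieEquiv (h : IsTwoStepType F L)
    (h' : IsTwoStepType F H) : Nonempty (L ≃ₗ⁅F⁆ H) := by
  obtain ⟨b, hb⟩ := h
  obtain ⟨b', hb'⟩ := h'
  exact hb.nonempty_lieEquiv hb' (by simp)

theorem IsThreeStepType.lieEquiv {ε : F} (h : IsThreeStepType F L ε)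
    (h' : IsThreeStepType F H ε) : Nonempty (L ≃ₗ⁅F⁆ H) := by
  obtain ⟨b, hb⟩ := h
  obtain ⟨b', hb'⟩ := h'
  exact hb.nonempty_lieEquiv hb' (by simp)

theorem IsFreeThreeStepType.lieEquiv (h : IsFreeThreeStepType F L)
    (h' : IsFreeThreeStepType F H) : Nonempty (L ≃ₗ⁅F⁆ H) := by
  obtain ⟨b, hb⟩ := h
  obtain ⟨b', hb'⟩ := h'
  exact hb.nonempty_lieEquiv hb' (by simp)

theorem IsFiliformType.lieEquiv {ε : F} (h : IsFiliformType F L ε)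
    (h' : IsFiliformType F H ε) : Nonempty (L ≃ₗ⁅F⁆ H) := by
  obtain ⟨b, hb⟩ := h
  obtain ⟨b', hb'⟩ := h'
  exact hb.nonempty_lieEquiv hb' (by simp)

theorem nonempty_lieEquiv_of_abelian (e : L ≃ₗ[F] H) (hL : ∀ x y : L, ⁅x, y⁆ = 0)
    (hH : ∀ x y : H, ⁅x, y⁆ = 0) : Nonempty (L ≃ₗ⁅F⁆ H) :=
  ⟨{ e with map_lie' := fun {x y} => by simp [hL, hH] }⟩

end Families

/-! ### The four named algebras in normal form. -/

section Models

variable (F : Type*) [Field F]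

theorem DeGraafLie.lie_def (k : DeGraafName) (x y : DeGraafLie k F) :
    ⁅x, y⁆ = DeGraafLie.bracket k x y := rfl

theorem DeGraafLie.zero_apply (k : DeGraafName) (i : Fin 5) : (0 : DeGraafLie k F) i = 0 := rfl

theorem DeGraafLie.smul_apply {k : DeGraafName} (a : F) (x : DeGraafLie k F) (i : Fin 5) :
    (a • x) i = a * x i := rfl

/-- The standard basis of a model algebra, reordered. -/
noncomputable def DeGraafLie.basis (k : DeGraafName) (σ : Equiv.Perm (Fin 5)) :
    Module.Basis (Fin 5) F (DeGraafLie k F) :=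
  (Pi.basisFun F (Fin 5)).reindex σ

theorem DeGraafLie.basis_apply (k : DeGraafName) (σ : Equiv.Perm (Fin 5)) (i : Fin 5) :
    DeGraafLie.basis F k σ i = (Pi.single (σ.symm i) 1 : Fin 5 → F) :=
  ((Pi.basisFun F (Fin 5)).reindex_apply σ i).trans (Pi.basisFun_apply F (Fin 5) (σ.symm i))

theorem isThreeStepType_L53 : IsThreeStepType F (DeGraafLie .L53 F) 0 := by
  -- The normal form keeps the last index for the triple bracket, which is x₄ in `L_{5,3}`; hence
  -- the swap with the central vector x₅.
  refine ⟨DeGraafLie.basis F .L53 (Equiv.swap 3 4), ?_⟩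
  constructor <;> rw [DeGraafLie.lie_def] <;> funext i <;>
    (try simp only [DeGraafLie.zero_apply, DeGraafLie.smul_apply]) <;>
    simp only [DeGraafLie.basis_apply] <;> fin_cases i <;>
    simp [DeGraafLie.bracket, Equiv.swap_apply_def]

theorem isThreeStepType_L55 : IsThreeStepType F (DeGraafLie .L55 F) 1 := by
  refine ⟨DeGraafLie.basis F .L55 (Equiv.refl _), ?_⟩
  constructor <;> rw [DeGraafLie.lie_def] <;> funext i <;>
    (try simp only [DeGraafLie.zero_apply, DeGraafLie.smul_apply]) <;>
    simp only [DeGraafLie.basis_apply] <;> fin_cases i <;>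
    simp [DeGraafLie.bracket]

theorem isFiliformType_L56 : IsFiliformType F (DeGraafLie .L56 F) 1 := by
  refine ⟨DeGraafLie.basis F .L56 (Equiv.refl _), ?_⟩
  constructor <;> rw [DeGraafLie.lie_def] <;> funext i <;>
    (try simp only [DeGraafLie.zero_apply, DeGraafLie.smul_apply]) <;>
    simp only [DeGraafLie.basis_apply] <;> fin_cases i <;>
    simp [DeGraafLie.bracket]

theorem isFiliformType_L57 : IsFiliformType F (DeGraafLie .L57 F) 0 := by
  refine ⟨DeGraafLie.basis F .L57 (Equiv.refl _), ?_⟩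
  constructor <;> rw [DeGraafLie.lie_def] <;> funext i <;>
    (try simp only [DeGraafLie.zero_apply, DeGraafLie.smul_apply]) <;>
    simp only [DeGraafLie.basis_apply] <;> fin_cases i <;>
    simp [DeGraafLie.bracket]

end Models

/-! ### Weighted nilpotent matrices as test representations. -/

namespace Matrix

/-- The matrices whose nonzero entries raise the weight of the index by at least `k`. -/
def weightSubmodule (F : Type*) [Field F] {n : ℕ} (w : Fin n → ℕ) (k : ℕ) :
    Submodule F (Matrix (Fin n) (Fin n) F) where
  carrier := {M | ∀ i j, w j < w i + k → M i j = 0}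
  add_mem' ha hb i j h := by rw [add_apply, ha i j h, hb i j h, add_zero]
  zero_mem' _ _ _ := rfl
  smul_mem' c M hM i j h := by rw [smul_apply, hM i j h, smul_zero]

variable {F : Type*} [Field F] {n : ℕ} {w : Fin n → ℕ}

theorem weightSubmodule_mul_le (a b : ℕ) :
    weightSubmodule F w a * weightSubmodule F w b ≤ weightSubmodule F w (a + b) := by
  rw [Submodule.mul_le]
  intro M hM N hN i j h
  rw [mul_apply]
  refine Finset.sum_eq_zero fun l _ => ?_
  by_cases hl : w l < w i + a
  · rw [hM i l hl, zero_mul]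
  · rw [hN l j (by omega), mul_zero]

theorem weightSubmodule_pow_le (k : ℕ) :
    weightSubmodule F w 1 ^ k ≤ weightSubmodule F w k := by
  induction k with
  | zero =>
    rw [pow_zero, Submodule.one_le]
    intro i j h
    exact one_apply_ne (by rintro rfl; omega)
  | succ k ih =>
    rw [pow_succ]
    exact (mul_le_mul' ih le_rfl).trans (weightSubmodule_mul_le k 1)

theorem single_mem_weightSubmodule {i j : Fin n} (h : w i + 1 ≤ w j) (c : F) :
    single i j c ∈ weightSubmodule F w 1 := by
  intro k l hkl
  refine single_apply_of_ne _ _ _ _ _ ?_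
  rintro ⟨rfl, rfl⟩
  omega

end Matrix

namespace UniversalEnvelopingAlgebra

section Reps

attribute [local instance] LieRing.ofAssociativeRing

variable {F L A : Type*} [Field F] [LieRing L] [LieAlgebra F L] [Ring A] [Algebra F A]

theorem exists_algHom_of_hasBrackets {b : Module.Basis (Fin 5) F L}
    {c01 c02 c03 c04 c12 c13 c14 c23 c24 c34 : L}
    (h : HasBrackets b c01 c02 c03 c04 c12 c13 c14 c23 c24 c34) (M : Fin 5 → A)
    (hM : let g := b.constr F M
      HasBrackets M (g c01) (g c02) (g c03) (g c04) (g c12) (g c13) (g c14) (g c23) (g c24)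
        (g c34)) :
    ∃ f : UniversalEnvelopingAlgebra F L →ₐ[F] A, ∀ i, f (incl F (b i)) = M i := by
  have h1 : (fun i => b.constr F M (b i)) = M := funext fun i => b.constr_basis F M i
  refine ⟨liftLinear (b.constr F M) fun x y => ?_, fun i => ?_⟩
  · rw [h.map_lie (b.constr F M) (by rw [h1]; exact hM) x y, LieRing.of_associative_ring_bracket]
  · rw [liftLinear_incl, b.constr_basis]

/-- If L acts by matrices raising the weight by at least one, ω^k raises it by at least k. So the
entry (i, j) is a functional that kills ω^k as soon as w j < w i + k. -/
theorem map_augIdeal_pow_le (b : Module.Basis (Fin 5) F L) {n : ℕ} {w : Fin n → ℕ}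
    {f : UniversalEnvelopingAlgebra F L →ₐ[F] Matrix (Fin n) (Fin n) F}
    (h : ∀ i, f (incl F (b i)) ∈ Matrix.weightSubmodule F w 1) {k : ℕ}
    {u : UniversalEnvelopingAlgebra F L} (hu : u ∈ augIdeal F L ^ k) :
    f u ∈ Matrix.weightSubmodule F w k := by
  have h1 : (augIdeal F L).map f.toLinearMap ≤ Matrix.weightSubmodule F w 1 := by
    rintro _ ⟨v, hv, rfl⟩
    refine apply_mem_of_mem_augIdeal f _ ?_ (fun x => ?_) hv
    · refine (Matrix.weightSubmodule_mul_le 1 1).trans fun M hM i j hij => hM i j (by omega)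
    · induction b.mem_span x using Submodule.span_induction with
      | zero => simp
      | add x y _ _ hx hy => rw [map_add, map_add]; exact Submodule.add_mem _ hx hy
      | smul a x _ hx => rw [map_smul, map_smul]; exact Submodule.smul_mem _ a hx
      | mem x hx => obtain ⟨j, rfl⟩ := hx; exact h j
  refine Matrix.weightSubmodule_pow_le k (pow_le_pow_left' h1 k ?_)
  rw [← Submodule.map_pow]
  exact ⟨u, hu, rfl⟩

open Matrix in
/-- A test representation of the five-dimensional Heisenberg algebra. -/
theorem exists_rep_heisenbergType (h : IsHeisenbergType F L 1) :
    ∃ b : Module.Basis (Fin 5) F L, HasBrackets b (b 4) 0 0 0 0 0 0 (b 4) 0 0 ∧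
      ∃ f : UniversalEnvelopingAlgebra F L →ₐ[F] Matrix (Fin 4) (Fin 4) F,
        f (incl F (b 4)) = single 0 3 1 ∧
        ∀ k, ∀ u ∈ augIdeal F L ^ k, f u ∈ weightSubmodule F ![0, 1, 1, 2] k := by
  obtain ⟨b, hb⟩ := h
  rw [one_smul] at hb
  obtain ⟨f, hf⟩ := exists_algHom_of_hasBrackets (A := Matrix (Fin 4) (Fin 4) F) hb
    ![single 0 1 1, single 1 3 1, single 0 2 1, single 2 3 1, single 0 3 (1 : F)] (by
      intro g
      constructor <;> simp [g, LieRing.of_associative_ring_bracket])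
  refine ⟨b, hb, f, hf 4, fun k u hu => map_augIdeal_pow_le b (fun i => ?_) hu⟩
  rw [hf]
  fin_cases i <;> exact single_mem_weightSubmodule (by decide) 1

open Matrix in
/-- A test representation of the algebras of three-step type. -/
theorem exists_rep_threeStepType {ε : F} (h : IsThreeStepType F L ε) :
    ∃ b : Module.Basis (Fin 5) F L, HasBrackets b (b 2) (b 4) 0 0 0 (ε • b 4) 0 0 0 0 ∧
      ∃ f : UniversalEnvelopingAlgebra F L →ₐ[F] Matrix (Fin 5) (Fin 5) F,
        f (incl F (b 4)) = single 0 4 1 ∧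
        ∀ k, ∀ u ∈ augIdeal F L ^ k, f u ∈ weightSubmodule F ![0, 1, 1, 2, 3] k := by
  obtain ⟨b, hb⟩ := h
  obtain ⟨f, hf⟩ := exists_algHom_of_hasBrackets (A := Matrix (Fin 5) (Fin 5) F) hb
    ![single 0 1 1 + single 1 3 1, single 0 2 1 + single 3 4 1, single 1 4 1, single 2 4 ε,
      single 0 4 (1 : F)] (by
      intro g
      constructor <;> simp [g, LieRing.of_associative_ring_bracket, add_mul, mul_add])
  refine ⟨b, hb, f, hf 4, fun k u hu => map_augIdeal_pow_le b (fun i => ?_) hu⟩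
  rw [hf]
  fin_cases i
  · exact Submodule.add_mem _ (single_mem_weightSubmodule (by decide) 1)
      (single_mem_weightSubmodule (by decide) 1)
  · exact Submodule.add_mem _ (single_mem_weightSubmodule (by decide) 1)
      (single_mem_weightSubmodule (by decide) 1)
  all_goals exact single_mem_weightSubmodule (by decide) _

open Matrix in
/-- A test representation of the algebras of filiform type. -/
theorem exists_rep_filiformType {ε : F} (h : IsFiliformType F L ε) :
    ∃ b : Module.Basis (Fin 5) F L, HasBrackets b (b 2) (b 3) (b 4) 0 (ε • b 4) 0 0 0 0 0 ∧
      ∃ f : UniversalEnvelopingAlgebra F L →ₐ[F] Matrix (Fin 5) (Fin 5) F,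
        f (incl F (b 4)) = single 0 4 1 ∧
        ∀ k, ∀ u ∈ augIdeal F L ^ k, f u ∈ weightSubmodule F ![0, 1, 2, 3, 4] k := by
  obtain ⟨b, hb⟩ := h
  obtain ⟨f, hf⟩ := exists_algHom_of_hasBrackets (A := Matrix (Fin 5) (Fin 5) F) hb
    ![single 0 1 1 + single 1 2 1 + single 2 3 1, single 1 3 (-ε) + single 3 4 1,
      single 0 3 (-ε) + single 2 4 1, single 1 4 1, single 0 4 (1 : F)] (by
      intro g
      constructor <;> simp [g, LieRing.of_associative_ring_bracket, add_mul, mul_add,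
        single_neg])
  refine ⟨b, hb, f, hf 4, fun k u hu => map_augIdeal_pow_le b (fun i => ?_) hu⟩
  rw [hf]
  fin_cases i
  · exact Submodule.add_mem _ (Submodule.add_mem _ (single_mem_weightSubmodule (by decide) 1)
      (single_mem_weightSubmodule (by decide) 1)) (single_mem_weightSubmodule (by decide) 1)
  · exact Submodule.add_mem _ (single_mem_weightSubmodule (by decide) _)
      (single_mem_weightSubmodule (by decide) 1)
  · exact Submodule.add_mem _ (single_mem_weightSubmodule (by decide) _)
      (single_mem_weightSubmodule (by decide) _)
  all_goals exact single_mem_weightSubmodule (by decide) _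

/-- As ω = L + ω², the products of two basis vectors span ω² modulo ω³. This reduces the functional
identities below to finite computations. -/
theorem apply_eq_zero_of_mem_augIdeal_sq (b : Module.Basis (Fin 5) F L)
    (ψ : UniversalEnvelopingAlgebra F L →ₗ[F] F) (h3 : ∀ u ∈ augIdeal F L ^ 3, ψ u = 0)
    (h2 : ∀ i j, ψ (incl F (b i) * incl F (b j)) = 0)
    {u : UniversalEnvelopingAlgebra F L} (hu : u ∈ augIdeal F L ^ 2) : ψ u = 0 := by
  have hb : ∀ x y, ψ (incl F x * incl F y) = 0 := fun x y => by
    induction b.mem_span x using Submodule.span_induction with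
    | zero => simp
    | add x x' _ _ hx hx' => rw [map_add, add_mul, map_add, hx, hx', add_zero]
    | smul a x _ hx => rw [map_smul, smul_mul_assoc, map_smul, hx, smul_zero]
    | mem x hx =>
      obtain ⟨i, rfl⟩ := hx
      induction b.mem_span y using Submodule.span_induction with
      | zero => simp
      | add y y' _ _ hy hy' => rw [map_add, mul_add, map_add, hy, hy', add_zero]
      | smul a y _ hy => rw [map_smul, mul_smul_comm, map_smul, hy, smul_zero]
      | mem y hy => obtain ⟨j, rfl⟩ := hy; exact h2 i j
  rw [pow_two] at hu
  induction hu using Submodule.mul_induction_on' with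
  | add x _ y _ hx hy => rw [map_add, hx, hy, add_zero]
  | mem_mul_mem m hm n hn =>
    have hm' := hm
    rw [augIdeal_eq] at hm hn
    obtain ⟨_, ⟨x, rfl⟩, r, hr, rfl⟩ := Submodule.mem_sup.1 hm
    obtain ⟨_, ⟨y, rfl⟩, s, hs, rfl⟩ := Submodule.mem_sup.1 hn
    rw [mul_add, map_add, add_mul, map_add, hb, zero_add, h3 (r * incl F y), h3, add_zero]
    · rw [show 3 = 1 + 2 from rfl, pow_add, pow_one]; exact Submodule.mul_mem_mul hm' hs
    · rw [pow_succ]; exact Submodule.mul_mem_mul hr (incl_mem_augIdeal y)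

open Matrix in
/-- A pair of test functionals for `L_{5,5}` in characteristic different from two. -/
theorem exists_functional_threeStepType (h2 : (2 : F) ≠ 0) (h : IsThreeStepType F L 1) :
    ∃ b : Module.Basis (Fin 5) F L, HasBrackets b (b 2) (b 4) 0 0 0 (b 4) 0 0 0 0 ∧
      ∃ p q : UniversalEnvelopingAlgebra F L →ₗ[F] F,
        (∀ u ∈ augIdeal F L ^ 3, p u = 0) ∧ p (incl F (b 2)) ≠ 0 ∧
        (∀ u ∈ augIdeal F L ^ 4, q u = 0) ∧ q (incl F (b 4)) ≠ 0 ∧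
        ∀ u ∈ augIdeal F L ^ 2, q ⁅u, incl F (b 1)⁆ = 0 := by
  obtain ⟨b, hb⟩ := h
  rw [one_smul] at hb
  obtain ⟨c, hc⟩ : ∃ c : F, c + c = 1 := ⟨2⁻¹, by rw [← two_mul, mul_inv_cancel₀ h2]⟩
  have hc0 : c ≠ 0 := by rintro rfl; simp at hc
  -- With c = 1/2, the entry (0, 5) is c on b₀b₂ and b₁b₃ and -c on b₂b₀ and b₃b₁. It takes the
  -- value 1 on b₄ and still vanishes on [b₀², b₁] = b₀b₂ + b₂b₀, the product that would spoil the
  -- last property.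
  obtain ⟨f, hf⟩ := exists_algHom_of_hasBrackets (A := Matrix (Fin 6) (Fin 6) F) hb
    ![single 0 1 1 + single 1 3 c + single 2 4 c + single 4 5 1, single 0 2 1 + single 3 5 1,
      single 1 5 c + single 0 4 (-c), single 0 3 (-c) + single 2 5 c, single 0 5 1] (by
      intro g
      constructor <;> simp [g, LieRing.of_associative_ring_bracket, add_mul, mul_add, single_neg,
        sub_eq_add_neg, ← single_add, hc])
  have hw : ∀ k, ∀ u ∈ augIdeal F L ^ k, f u ∈ weightSubmodule F ![0, 1, 1, 2, 2, 3] k := by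
    refine fun k u hu => map_augIdeal_pow_le b (fun i => ?_) hu
    rw [hf]
    fin_cases i
    · exact Submodule.add_mem _ (Submodule.add_mem _ (Submodule.add_mem _
        (single_mem_weightSubmodule (by decide) _) (single_mem_weightSubmodule (by decide) _))
        (single_mem_weightSubmodule (by decide) _)) (single_mem_weightSubmodule (by decide) _)
    · exact Submodule.add_mem _ (single_mem_weightSubmodule (by decide) _)
        (single_mem_weightSubmodule (by decide) _)
    · exact Submodule.add_mem _ (single_mem_weightSubmodule (by decide) _)
        (single_mem_weightSubmodule (by decide) _)
    · exact Submodule.add_mem _ (single_mem_weightSubmodule (by decide) _)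
        (single_mem_weightSubmodule (by decide) _)
    · exact single_mem_weightSubmodule (by decide) _
  let q : UniversalEnvelopingAlgebra F L →ₗ[F] F := Matrix.entryLinearMap F F 0 5 ∘ₗ f.toLinearMap
  have hq : ∀ u, q u = f u 0 5 := fun _ => rfl
  refine ⟨b, hb, Matrix.entryLinearMap F F 0 4 ∘ₗ f.toLinearMap, q,
    fun u hu => hw 3 u hu 0 4 (by decide), ?_, fun u hu => hw 4 u hu 0 5 (by decide), ?_, ?_⟩
  · change f (incl F (b 2)) 0 4 ≠ 0
    rw [hf]
    simpa [single_apply] using hc0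
  · rw [hq, hf]
    simp
  · intro u hu
    let ψ : UniversalEnvelopingAlgebra F L →ₗ[F] F :=
      { toFun := fun u => q ⁅u, incl F (b 1)⁆
        map_add' := fun u v => by rw [add_lie, map_add]
        map_smul' := fun a u => by rw [smul_lie, map_smul, RingHom.id_apply] }
    refine apply_eq_zero_of_mem_augIdeal_sq b ψ (fun u hu => ?_) (fun i j => ?_) hu
    · refine hw 4 _ (lie_mem_augIdeal_pow (i := 3) (j := 1) hu ?_) 0 5 (by decide)
      rw [pow_one]; exact incl_mem_augIdeal _
    · change f ⁅incl F (b i) * incl F (b j), incl F (b 1)⁆ 0 5 = 0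
      simp only [LieRing.of_associative_ring_bracket, map_sub, map_mul, hf]
      fin_cases i <;> fin_cases j <;> simp [add_mul, mul_add]

set_option maxHeartbeats 600000 in
open Matrix in
/-- A pair of test functionals for `L_{5,6}` in characteristic different from two. -/
theorem exists_functional_filiformType (h2 : (2 : F) ≠ 0) (h : IsFiliformType F L 1) :
    ∃ b : Module.Basis (Fin 5) F L, HasBrackets b (b 2) (b 3) (b 4) 0 (b 4) 0 0 0 0 0 ∧
      ∃ p q : UniversalEnvelopingAlgebra F L →ₗ[F] F,
        (∀ u ∈ augIdeal F L ^ 4, p u = 0) ∧ p (incl F (b 3)) ≠ 0 ∧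
        (∀ u ∈ augIdeal F L ^ 5, q u = 0) ∧ q (incl F (b 4)) ≠ 0 ∧
        (∀ u ∈ augIdeal F L ^ 2,
          q (⁅u, incl F (b 2)⁆ + ⁅incl F (b 1), ⁅incl F (b 0), u⁆⁆) = 0) ∧
        ∀ u ∈ augIdeal F L ^ 2, q ⁅incl F (b 1), ⁅incl F (b 1), u⁆⁆ = 0 := by
  obtain ⟨b, hb⟩ := h
  rw [one_smul] at hb
  obtain ⟨c, hc⟩ : ∃ c : F, c + c = 1 := ⟨2⁻¹, by rw [← two_mul, mul_inv_cancel₀ h2]⟩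
  -- Again the entry (0, 7) is antisymmetric where it matters: c on b₀b₃ and b₁b₂, -c on b₃b₀ and
  -- b₂b₁. In particular it vanishes on [b₀², b₂] = b₀b₃ + b₃b₀.
  obtain ⟨f, hf⟩ := exists_algHom_of_hasBrackets (A := Matrix (Fin 8) (Fin 8) F) hb
    ![single 0 1 1 + single 1 3 1 + single 3 5 1 + single 2 4 1 + single 4 6 1 + single 6 7 (-c),
      single 0 2 1 + single 5 7 c + single 4 7 c,
      single 3 7 c + (single 2 7 c + single 0 4 (-1)), single 1 7 c + single 0 6 1,
      single 0 7 1] (by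
      intro g
      constructor <;> simp [g, LieRing.of_associative_ring_bracket, add_mul, mul_add, single_neg,
        sub_eq_add_neg, ← single_add, hc, add_assoc])
  have hw : ∀ k, ∀ u ∈ augIdeal F L ^ k, f u ∈ weightSubmodule F ![0, 1, 1, 2, 2, 3, 3, 4] k := by
    refine fun k u hu => map_augIdeal_pow_le b (fun i => ?_) hu
    rw [hf]
    fin_cases i
    · exact Submodule.add_mem _ (Submodule.add_mem _ (Submodule.add_mem _ (Submodule.add_mem _
        (Submodule.add_mem _ (single_mem_weightSubmodule (by decide) _)
        (single_mem_weightSubmodule (by decide) _)) (single_mem_weightSubmodule (by decide) _))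
        (single_mem_weightSubmodule (by decide) _)) (single_mem_weightSubmodule (by decide) _))
        (single_mem_weightSubmodule (by decide) _)
    · exact Submodule.add_mem _ (Submodule.add_mem _ (single_mem_weightSubmodule (by decide) _)
        (single_mem_weightSubmodule (by decide) _)) (single_mem_weightSubmodule (by decide) _)
    · exact Submodule.add_mem _ (single_mem_weightSubmodule (by decide) _)
        (Submodule.add_mem _ (single_mem_weightSubmodule (by decide) _)
        (single_mem_weightSubmodule (by decide) _))
    · exact Submodule.add_mem _ (single_mem_weightSubmodule (by decide) _)
        (single_mem_weightSubmodule (by decide) _)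
    · exact single_mem_weightSubmodule (by decide) _
  let q : UniversalEnvelopingAlgebra F L →ₗ[F] F := Matrix.entryLinearMap F F 0 7 ∘ₗ f.toLinearMap
  have hq : ∀ u, q u = f u 0 7 := fun _ => rfl
  have h1 : ∀ x : L, incl F x ∈ augIdeal F L ^ 1 := fun x => by
    rw [pow_one]; exact incl_mem_augIdeal _
  have hb2 : incl F (b 2) ∈ augIdeal F L ^ 2 := by
    rw [← hb.h01, incl_lie, ← LieRing.of_associative_ring_bracket]
    exact lie_mem_augIdeal_pow (h1 _) (h1 _)
  refine ⟨b, hb, Matrix.entryLinearMap F F 0 6 ∘ₗ f.toLinearMap, q,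
    fun u hu => hw 4 u hu 0 6 (by decide), ?_, fun u hu => hw 5 u hu 0 7 (by decide), ?_, ?_, ?_⟩
  · change f (incl F (b 3)) 0 6 ≠ 0
    rw [hf]
    simp
  · rw [hq, hf]
    simp
  · intro u hu
    let ψ : UniversalEnvelopingAlgebra F L →ₗ[F] F :=
      { toFun := fun u => q (⁅u, incl F (b 2)⁆ + ⁅incl F (b 1), ⁅incl F (b 0), u⁆⁆)
        map_add' := fun u v => by
          rw [add_lie, lie_add, lie_add, ← map_add]
          congr 1
          abel
        map_smul' := fun a u => by
          rw [smul_lie, lie_smul, lie_smul, ← smul_add, map_smul, RingHom.id_apply] }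
    refine apply_eq_zero_of_mem_augIdeal_sq b ψ (fun u hu => ?_) (fun i j => ?_) hu
    · refine hw 5 _ (Submodule.add_mem _ ?_ ?_) 0 7 (by decide)
      · exact lie_mem_augIdeal_pow (i := 3) (j := 2) hu hb2
      · exact lie_mem_augIdeal_pow (i := 1) (j := 4) (h1 _)
          (lie_mem_augIdeal_pow (i := 1) (j := 3) (h1 _) hu)
    · change f (⁅incl F (b i) * incl F (b j), incl F (b 2)⁆ +
        ⁅incl F (b 1), ⁅incl F (b 0), incl F (b i) * incl F (b j)⁆⁆) 0 7 = 0
      simp only [LieRing.of_associative_ring_bracket, map_add, map_sub, map_mul, hf]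
      fin_cases i <;> fin_cases j <;> simp [add_mul, mul_add]
  · intro u hu
    let ψ : UniversalEnvelopingAlgebra F L →ₗ[F] F :=
      { toFun := fun u => q ⁅incl F (b 1), ⁅incl F (b 1), u⁆⁆
        map_add' := fun u v => by rw [lie_add, lie_add, map_add]
        map_smul' := fun a u => by rw [lie_smul, lie_smul, map_smul, RingHom.id_apply] }
    refine apply_eq_zero_of_mem_augIdeal_sq b ψ (fun u hu => ?_) (fun i j => ?_) hu
    · refine hw 5 _ ?_ 0 7 (by decide)
      exact lie_mem_augIdeal_pow (i := 1) (j := 4) (h1 _)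
          (lie_mem_augIdeal_pow (i := 1) (j := 3) (h1 _) hu)
    · change f ⁅incl F (b 1), ⁅incl F (b 1), incl F (b i) * incl F (b j)⁆⁆ 0 7 = 0
      simp only [LieRing.of_associative_ring_bracket, map_sub, map_mul, hf]
      fin_cases i <;> fin_cases j <;> simp [add_mul, mul_add, mul_sub]

end Reps
end UniversalEnvelopingAlgebra

/-! ### Brackets with basis vectors, and the derived subspace. -/

section

variable {F L : Type*} [Field F] [LieRing L] [LieAlgebra F L] {b : Module.Basis (Fin 5) F L}
  {c01 c02 c03 c04 c12 c13 c14 c23 c24 c34 : L}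

theorem HasBrackets.lie_basis
    (h : HasBrackets b c01 c02 c03 c04 c12 c13 c14 c23 c24 c34) (x : L) :
    let t := b.repr x
    ⁅x, b 0⁆ = -(t 1 • c01 + t 2 • c02 + t 3 • c03 + t 4 • c04) ∧
    ⁅x, b 1⁆ = t 0 • c01 - (t 2 • c12 + t 3 • c13 + t 4 • c14) ∧
    ⁅x, b 2⁆ = t 0 • c02 + t 1 • c12 - (t 3 • c23 + t 4 • c24) ∧
    ⁅x, b 3⁆ = t 0 • c03 + t 1 • c13 + t 2 • c23 - t 4 • c34 ∧
    ⁅x, b 4⁆ = t 0 • c04 + t 1 • c14 + t 2 • c24 + t 3 • c34 := by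
  intro t
  obtain ⟨h01, h02, h03, h04, h12, h13, h14, h23, h24, h34⟩ := h
  have hx : x = t 0 • b 0 + t 1 • b 1 + t 2 • b 2 + t 3 • b 3 + t 4 • b 4 := by
    rw [← Fin.sum_univ_five fun i => t i • b i]; exact (b.sum_repr x).symm
  have hs : ∀ {i j : Fin 5} {c : L}, ⁅b i, b j⁆ = c → ⁅b j, b i⁆ = -c := fun h => by
    rw [← h, lie_skew]
  rw [hx]
  simp only [add_lie, smul_lie, lie_self, h01, h02, h03, h04, h12, h13, h14, h23, h24, h34,
    hs h01, hs h02, hs h03, hs h04, hs h12, hs h13, hs h14, hs h23, hs h24, hs h34, smul_neg,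
    smul_zero]
  refine ⟨?_, ?_, ?_, ?_, ?_⟩ <;> abel

theorem HasBrackets.lie_mem
    (h : HasBrackets b c01 c02 c03 c04 c12 c13 c14 c23 c24 c34) (S : Submodule F L)
    (hS : c01 ∈ S ∧ c02 ∈ S ∧ c03 ∈ S ∧ c04 ∈ S ∧ c12 ∈ S ∧ c13 ∈ S ∧ c14 ∈ S ∧ c23 ∈ S ∧
      c24 ∈ S ∧ c34 ∈ S) (x y : L) : ⁅x, y⁆ ∈ S := by
  obtain ⟨h01, h02, h03, h04, h12, h13, h14, h23, h24, h34⟩ := hS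
  obtain ⟨h0, h1, h2, h3, h4⟩ := h.lie_basis x
  have hb : ∀ j, ⁅x, b j⁆ ∈ S := fun j => by
    fin_cases j
    · refine h0 ▸ ?_
      exact S.neg_mem (S.add_mem (S.add_mem (S.add_mem (S.smul_mem _ h01) (S.smul_mem _ h02))
        (S.smul_mem _ h03)) (S.smul_mem _ h04))
    · refine h1 ▸ ?_
      exact S.sub_mem (S.smul_mem _ h01) (S.add_mem (S.add_mem (S.smul_mem _ h12)
        (S.smul_mem _ h13)) (S.smul_mem _ h14))
    · refine h2 ▸ ?_
      exact S.sub_mem (S.add_mem (S.smul_mem _ h02) (S.smul_mem _ h12))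
        (S.add_mem (S.smul_mem _ h23) (S.smul_mem _ h24))
    · refine h3 ▸ ?_
      exact S.sub_mem (S.add_mem (S.add_mem (S.smul_mem _ h03) (S.smul_mem _ h13))
        (S.smul_mem _ h23)) (S.smul_mem _ h34)
    · refine h4 ▸ ?_
      exact S.add_mem (S.add_mem (S.add_mem (S.smul_mem _ h04) (S.smul_mem _ h14))
        (S.smul_mem _ h24)) (S.smul_mem _ h34)
  induction b.mem_span y using Submodule.span_induction with
  | zero => simp
  | add y z _ _ hy hz => rw [lie_add]; exact S.add_mem hy hz
  | smul a y _ hy => rw [lie_smul]; exact S.smul_mem a hy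
  | mem y hy => obtain ⟨j, rfl⟩ := hy; exact hb j

end

/-- The span of all brackets of a Lie algebra. -/
def derivedSubmodule (F L : Type*) [Field F] [LieRing L] [LieAlgebra F L] : Submodule F L :=
  Submodule.span F {z | ∃ x y : L, ⁅x, y⁆ = z}

theorem lie_mem_derivedSubmodule {F L : Type*} [Field F] [LieRing L] [LieAlgebra F L] (x y : L) :
    ⁅x, y⁆ ∈ derivedSubmodule F L :=
  Submodule.subset_span ⟨x, y, rfl⟩

/-! ### Recovering the abelianization from ω/ω². -/

namespace UniversalEnvelopingAlgebra

section Invariants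

attribute [local instance] LieRing.ofAssociativeRing

variable {F L H : Type*} [Field F] [LieRing L] [LieAlgebra F L] [LieRing H] [LieAlgebra F H]

theorem incl_lie_eq_lie (x y : L) : incl F ⁅x, y⁆ = ⁅incl F x, incl F y⁆ := incl_lie x y

theorem incl_mem_augIdeal_pow_one (x : L) : incl F x ∈ augIdeal F L ^ 1 := by
  rw [pow_one]; exact incl_mem_augIdeal x

theorem incl_lie_mem_augIdeal_pow {k : ℕ} (x : L) {y : L} (hy : incl F y ∈ augIdeal F L ^ k) :
    incl F ⁅x, y⁆ ∈ augIdeal F L ^ (1 + k) := by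
  rw [incl_lie_eq_lie]
  exact lie_mem_augIdeal_pow (incl_mem_augIdeal_pow_one x) hy

theorem exists_eq_incl_add {u : UniversalEnvelopingAlgebra F L} (hu : u ∈ augIdeal F L) :
    ∃ x : L, ∃ r ∈ augIdeal F L ^ 2, u = incl F x + r := by
  rw [augIdeal_eq] at hu
  obtain ⟨_, ⟨x, rfl⟩, r, hr, rfl⟩ := Submodule.mem_sup.1 hu
  exact ⟨x, r, hr, rfl⟩

/-- The projection of the enveloping algebra onto an abelian quotient of the Lie algebra. -/
theorem exists_proj_quotient (D : Submodule F L) (hD : ∀ x y : L, ⁅x, y⁆ ∈ D) :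
    ∃ π : UniversalEnvelopingAlgebra F L →ₗ[F] L ⧸ D,
      (∀ x, π (incl F x) = D.mkQ x) ∧ ∀ u ∈ augIdeal F L ^ 2, π u = 0 := by
  -- Here x acts on F × L/D by (a, v) ↦ (0, a·x̄). Products of two such operators vanish, as do the
  -- images of brackets, so this is a representation that kills ω².
  let g : L →ₗ[F] Module.End F (F × (L ⧸ D)) :=
    { toFun := fun x => LinearMap.inr F F (L ⧸ D) ∘ₗ
        LinearMap.toSpanSingleton F (L ⧸ D) (D.mkQ x) ∘ₗ LinearMap.fst F F (L ⧸ D)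
      map_add' := fun x y => by ext <;> simp
      map_smul' := fun a x => by ext <;> simp }
  have hg : ∀ x p, g x p = (0, p.1 • D.mkQ x) := fun _ _ => rfl
  let f := liftLinear g fun x y => by
    refine LinearMap.ext fun p => ?_
    rw [LinearMap.sub_apply, Module.End.mul_apply, Module.End.mul_apply, hg, hg, hg, hg, hg]
    simp [(Submodule.Quotient.mk_eq_zero D).2 (hD x y)]
  -- The operators with image in 0 × L/D that also kill it: a space of square zero containing the
  -- image of ω.
  let J : Submodule F (Module.End F (F × (L ⧸ D))) :=
    { carrier := {T | ∀ p, (T p).1 = 0 ∧ T (0, p.2) = 0}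
      add_mem' := fun ha hb p => by simp [ha p, hb p]
      zero_mem' := fun p => by simp
      smul_mem' := fun a T hT p => by simp [hT p] }
  have hJ : J * J ≤ ⊥ := by
    rw [Submodule.mul_le]
    intro S hS T hT
    rw [Submodule.mem_bot]
    refine LinearMap.ext fun p => ?_
    have h1 : T p = (0, (T p).2) := Prod.ext (hT p).1 rfl
    rw [Module.End.mul_apply, h1]
    exact (hS (T p)).2
  have hf : ∀ u ∈ augIdeal F L, f u ∈ J := fun u hu =>
    apply_mem_of_mem_augIdeal f J (hJ.trans bot_le)
      (fun x => by rw [liftLinear_incl]; exact fun p => ⟨rfl, by simp [hg]⟩) hu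
  refine ⟨LinearMap.snd F F (L ⧸ D) ∘ₗ LinearMap.applyₗ ((1 : F), (0 : L ⧸ D)) ∘ₗ f.toLinearMap,
    fun x => ?_, fun u hu => ?_⟩
  · change (f (incl F x) (1, 0)).2 = _
    rw [liftLinear_incl, hg]
    simp
  · change (f u (1, 0)).2 = 0
    have : f u = 0 := by
      have h2 : (augIdeal F L).map f.toLinearMap ≤ J := by
        rintro _ ⟨v, hv, rfl⟩; exact hf v hv
      have h3 : (augIdeal F L ^ 2).map f.toLinearMap ≤ ⊥ := by
        rw [Submodule.map_pow, pow_two]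
        exact (mul_le_mul' h2 h2).trans hJ
      exact h3 ⟨u, hu, rfl⟩
    rw [this]
    rfl

theorem mem_of_incl_mem_augIdeal_sq {D : Submodule F L} (hD : ∀ x y : L, ⁅x, y⁆ ∈ D) {x : L}
    (hx : incl F x ∈ augIdeal F L ^ 2) : x ∈ D := by
  obtain ⟨π, h1, h2⟩ := exists_proj_quotient D hD
  rw [← Submodule.Quotient.mk_eq_zero D, ← Submodule.mkQ_apply, ← h1, h2 _ hx]

theorem map_mem_augIdeal_pow_iff
    {ψ : UniversalEnvelopingAlgebra F L ≃ₐ[F] UniversalEnvelopingAlgebra F H}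
    (hψ : ∀ u, augmentation F H (ψ u) = augmentation F L u) {k : ℕ}
    {u : UniversalEnvelopingAlgebra F L} :
    ψ u ∈ augIdeal F H ^ k ↔ u ∈ augIdeal F L ^ k := by
  rw [← map_augIdeal_pow ψ hψ k]
  exact ⟨fun ⟨v, hv, h⟩ => ψ.injective h ▸ hv, fun h => ⟨u, h, rfl⟩⟩

end Invariants
end UniversalEnvelopingAlgebra

/-! ### Obstructions to isomorphism. -/

namespace UniversalEnvelopingAlgebra

section Obstructions

attribute [local instance] LieRing.ofAssociativeRing

variable {F L H : Type*} [Field F] [LieRing L] [LieAlgebra F L] [LieRing H] [LieAlgebra F H]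
  {ψ : UniversalEnvelopingAlgebra F L ≃ₐ[F] UniversalEnvelopingAlgebra F H}

theorem algEquiv_lie (ψ : UniversalEnvelopingAlgebra F L ≃ₐ[F] UniversalEnvelopingAlgebra F H)
    (u v : UniversalEnvelopingAlgebra F L) : ψ ⁅u, v⁆ = ⁅ψ u, ψ v⁆ := by
  simp only [LieRing.of_associative_ring_bracket, map_sub, map_mul]

/-- The composite L → U(L) → U(H) → H/[H,H] kills brackets because these lie in ω². It is onto since
the preimage of each element of H is an element of L up to ω². Applied in both directions, it gives
equality. -/
theorem finrank_quotient_derivedSubmodule_le [Module.Finite F L]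
    (hψ : ∀ u, augmentation F H (ψ u) = augmentation F L u) :
    Module.finrank F (H ⧸ derivedSubmodule F H) ≤ Module.finrank F (L ⧸ derivedSubmodule F L) := by
  obtain ⟨π, h1, h2⟩ := exists_proj_quotient (derivedSubmodule F H) lie_mem_derivedSubmodule
  let g : L →ₗ[F] H ⧸ derivedSubmodule F H := π ∘ₗ ψ.toLinearMap ∘ₗ incl F
  have hg : ∀ x, g x = π (ψ (incl F x)) := fun _ => rfl
  have hker : derivedSubmodule F L ≤ LinearMap.ker g := by
    rw [derivedSubmodule, Submodule.span_le]
    rintro _ ⟨x, y, rfl⟩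
    refine h2 _ ((map_mem_augIdeal_pow_iff hψ).2 ?_)
    exact incl_lie_mem_augIdeal_pow x (incl_mem_augIdeal_pow_one y)
  refine LinearMap.finrank_le_finrank_of_surjective (f := (derivedSubmodule F L).liftQ g hker) ?_
  intro q
  obtain ⟨h, rfl⟩ := Submodule.mkQ_surjective _ q
  have hu : ψ.symm (incl F h) ∈ augIdeal F L := by
    rw [mem_augIdeal, ← hψ, ψ.apply_symm_apply, augmentation_incl]
  obtain ⟨x, r, hr, hx⟩ := exists_eq_incl_add hu
  refine ⟨Submodule.Quotient.mk x, ?_⟩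
  rw [Submodule.liftQ_apply, hg, ← h1, ← ψ.apply_symm_apply (incl F h), hx, map_add, map_add,
    h2 _ ((map_mem_augIdeal_pow_iff hψ).2 hr), add_zero]

/-- A central element of the Lie algebra outside the derived algebra gives a Lie algebra element
that is central up to a correction by products. -/
theorem exists_almost_central (hψ : ∀ u, augmentation F H (ψ u) = augmentation F L u)
    {D : Submodule F L} (hD : ∀ x y : L, ⁅x, y⁆ ∈ D) {z : L} (hz : ∀ y : L, ⁅z, y⁆ = 0)
    (hzD : z ∉ D) :
    ∃ x : H, ∃ r ∈ augIdeal F H ^ 2, incl F x ∉ augIdeal F H ^ 2 ∧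
      ∀ y : H, incl F ⁅x, y⁆ = -⁅r, incl F y⁆ := by
  have hc : ∀ u : UniversalEnvelopingAlgebra F H, ⁅ψ (incl F z), u⁆ = 0 := fun u => by
    obtain ⟨v, rfl⟩ := ψ.surjective u
    rw [← algEquiv_lie]
    have hv : v ∈ Algebra.adjoin F (Set.range (incl F : L → UniversalEnvelopingAlgebra F L)) := by
      rw [adjoin_range_incl]; trivial
    rw [map_eq_zero_iff ψ ψ.injective, LieRing.of_associative_ring_bracket, sub_eq_zero]
    induction hv using Algebra.adjoin_induction with
    | mem x hx =>
      obtain ⟨y, rfl⟩ := hx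
      rw [← sub_eq_zero, ← incl_lie, hz, map_zero]
    | algebraMap a => exact (Algebra.commutes a _).symm
    | add x y _ _ hx hy => rw [mul_add, add_mul, hx, hy]
    | mul x y _ _ hx hy => rw [← mul_assoc, hx, mul_assoc, hy, mul_assoc]
  obtain ⟨x, r, hr, hx⟩ := exists_eq_incl_add (u := ψ (incl F z)) (by
    rw [mem_augIdeal, hψ, augmentation_incl])
  refine ⟨x, r, hr, fun h => hzD (mem_of_incl_mem_augIdeal_sq hD ?_), fun y => ?_⟩
  · rw [← map_mem_augIdeal_pow_iff hψ, hx]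
    exact Submodule.add_mem _ h hr
  · rw [incl_lie_eq_lie, eq_neg_iff_add_eq_zero, ← add_lie, ← hx, hc]

/-- The vector `c 2` is central and outside the derived algebra. Its counterpart x in H satisfies
[x, y] ∈ ω³ for all y, while b₄ is not in ω³; so x commutes with everything and is a multiple of b₄,
which lies in ω². -/
theorem not_heisenbergType (hψ : ∀ u, augmentation F H (ψ u) = augmentation F L u)
    (hL : IsHeisenbergType F L 0) (hH : IsHeisenbergType F H 1) : False := by
  obtain ⟨c, hc⟩ := hL
  rw [zero_smul] at hc
  obtain ⟨b, hb, f, hf, hw⟩ := exists_rep_heisenbergType hH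
  obtain ⟨x, r, hr, hx, hxr⟩ := exists_almost_central (z := c 2)
    (D := LinearMap.ker (c.coord 2)) hψ (hc.lie_mem _ (by simp))
    (fun y => by
      rw [← lie_skew, neg_eq_zero, (hc.lie_basis y).2.2.1]; simp) (by simp)
  have key : ∀ y, f (incl F ⁅x, y⁆) 0 3 = 0 := fun y => by
    rw [hxr]
    refine hw 3 _ (Submodule.neg_mem _ ?_) 0 3 (by decide)
    exact lie_mem_augIdeal_pow (i := 2) (j := 1) hr (incl_mem_augIdeal_pow_one y)
  obtain ⟨h0, h1, h2, h3, -⟩ := hb.lie_basis x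
  have k0 := key (b 1)
  have k1 := key (b 0)
  have k2 := key (b 3)
  have k3 := key (b 2)
  rw [h1] at k0
  rw [h0] at k1
  rw [h3] at k2
  rw [h2] at k3
  simp [hf] at k0 k1 k2 k3
  have hx4 : x = b.repr x 4 • b 4 := by
    conv_lhs => rw [← b.sum_repr x, Fin.sum_univ_five, k0, k1, k2, k3]
    simp
  apply hx
  rw [hx4, map_smul, ← hb.h01]
  exact Submodule.smul_mem _ _ (incl_lie_mem_augIdeal_pow _ (incl_mem_augIdeal_pow_one _))

/-- Applied to the central vector `c 3`, the functional `p` removes the coordinates 0 and 1 of x.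
The coordinate 3 only shows in [x, b₁] as a multiple of b₄ ∈ ω³, the same depth as [r, b₁]; so there
`q` is needed, which kills [r, b₁] altogether. -/
theorem not_threeStepType (h2 : (2 : F) ≠ 0)
    (hψ : ∀ u, augmentation F H (ψ u) = augmentation F L u)
    (hL : IsThreeStepType F L 0) (hH : IsThreeStepType F H 1) : False := by
  obtain ⟨c, hc⟩ := hL
  rw [zero_smul] at hc
  obtain ⟨b, hb, p, q, hp, hp2, hq, hq4, hqr⟩ := exists_functional_threeStepType h2 hH
  obtain ⟨x, r, hr, hx, hxr⟩ := exists_almost_central (z := c 3)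
    (D := LinearMap.ker (c.coord 3)) hψ (hc.lie_mem _ (by simp))
    (fun y => by
      rw [← lie_skew, neg_eq_zero, (hc.lie_basis y).2.2.2.1]; simp) (by simp)
  have key : ∀ y, p (incl F ⁅x, y⁆) = 0 := fun y => by
    rw [hxr]
    refine hp _ (Submodule.neg_mem _ ?_)
    exact lie_mem_augIdeal_pow (i := 2) (j := 1) hr (incl_mem_augIdeal_pow_one y)
  have m2 : incl F (b 2) ∈ augIdeal F H ^ 2 := by
    rw [← hb.h01]
    exact incl_lie_mem_augIdeal_pow _ (incl_mem_augIdeal_pow_one _)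
  have m4 : incl F (b 4) ∈ augIdeal F H ^ 3 := by
    rw [← hb.h02]
    exact incl_lie_mem_augIdeal_pow _ m2
  obtain ⟨h0, h1, -⟩ := hb.lie_basis x
  have k0 := key (b 1)
  have k1 := key (b 0)
  rw [h1] at k0
  rw [h0] at k1
  simp [hp _ m4, hp2] at k0 k1
  have k3 : q (incl F ⁅x, b 1⁆) = 0 := by rw [hxr, map_neg, hqr r hr, neg_zero]
  rw [h1, k0] at k3
  simp [hq4] at k3
  have hx4 : x = b.repr x 2 • b 2 + b.repr x 4 • b 4 := by
    conv_lhs => rw [← b.sum_repr x, Fin.sum_univ_five, k0, k1, k3]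
    simp
  apply hx
  rw [hx4, map_add, map_smul, map_smul]
  exact Submodule.add_mem _ (Submodule.smul_mem _ _ m2)
    (Submodule.smul_mem _ _ (augIdeal_pow_le (by norm_num) (by norm_num) m4))

/-- Commutators in the enveloping algebra are to leading order brackets in the Lie algebra. -/
theorem exists_lie_sub_incl_mem {k : ℕ} (hk : 1 ≤ k) {u v : UniversalEnvelopingAlgebra F L}
    (hu : u ∈ augIdeal F L) {y : L} (hy : incl F y ∈ augIdeal F L ^ k)
    (hv : v - incl F y ∈ augIdeal F L ^ (k + 1)) :
    ∃ x : L, incl F ⁅x, y⁆ ∈ augIdeal F L ^ (k + 1) ∧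
      ⁅u, v⁆ - incl F ⁅x, y⁆ ∈ augIdeal F L ^ (k + 2) := by
  obtain ⟨x, r, hr, rfl⟩ := exists_eq_incl_add hu
  obtain ⟨s, rfl⟩ : ∃ s, v = incl F y + s := ⟨v - incl F y, by abel⟩
  rw [add_sub_cancel_left] at hv
  refine ⟨x, add_comm 1 k ▸ incl_lie_mem_augIdeal_pow x hy, ?_⟩
  rw [add_lie, lie_add, incl_lie_eq_lie, add_assoc, add_sub_cancel_left]
  refine Submodule.add_mem _ ?_ ?_
  · have := lie_mem_augIdeal_pow (incl_mem_augIdeal_pow_one x) hv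
    rwa [show 1 + (k + 1) = k + 2 by ring] at this
  · rw [add_comm k 2]
    exact lie_mem_augIdeal_pow hr (Submodule.add_mem _ hy (augIdeal_pow_le hk (by omega) hv))

theorem exists_sub_incl_mem {u : UniversalEnvelopingAlgebra F L} (hu : u ∈ augIdeal F L) :
    ∃ x : L, u - incl F x ∈ augIdeal F L ^ 2 := by
  obtain ⟨x, r, hr, rfl⟩ := exists_eq_incl_add hu
  exact ⟨x, by rwa [add_sub_cancel_left]⟩

/-- The double commutator agrees with a double bracket of L up to ω⁴. When the latter vanishes, one
step of the filtration is gained. -/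
theorem lie_lie_mem (hL : ∀ x y z : L, ⁅x, ⁅y, z⁆⁆ = 0) {u v w : UniversalEnvelopingAlgebra F L}
    (hu : u ∈ augIdeal F L) (hv : v ∈ augIdeal F L) (hw : w ∈ augIdeal F L) :
    ⁅u, ⁅v, w⁆⁆ ∈ augIdeal F L ^ 4 := by
  obtain ⟨z, hz⟩ := exists_sub_incl_mem hw
  obtain ⟨y, hy, hy'⟩ := exists_lie_sub_incl_mem le_rfl hv (incl_mem_augIdeal_pow_one z) hz
  obtain ⟨x, -, hx⟩ := exists_lie_sub_incl_mem (by norm_num) hu hy hy'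
  rwa [hL, map_zero, sub_zero] at hx

theorem lie_lie_lie_mem (hL : ∀ x y z w : L, ⁅x, ⁅y, ⁅z, w⁆⁆⁆ = 0)
    {u v w t : UniversalEnvelopingAlgebra F L} (hu : u ∈ augIdeal F L) (hv : v ∈ augIdeal F L)
    (hw : w ∈ augIdeal F L) (ht : t ∈ augIdeal F L) :
    ⁅u, ⁅v, ⁅w, t⁆⁆⁆ ∈ augIdeal F L ^ 5 := by
  obtain ⟨z, hz⟩ := exists_sub_incl_mem ht
  obtain ⟨y, hy, hy'⟩ := exists_lie_sub_incl_mem le_rfl hw (incl_mem_augIdeal_pow_one z) hz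
  obtain ⟨x, hx, hx'⟩ := exists_lie_sub_incl_mem (by norm_num) hv hy hy'
  obtain ⟨s, -, hs⟩ := exists_lie_sub_incl_mem (by norm_num) hu hx hx'
  rwa [hL, map_zero, sub_zero] at hs

theorem exists_map_eq_incl (hψ : ∀ u, augmentation F H (ψ u) = augmentation F L u) (x : H) :
    ∃ u ∈ augIdeal F L, ψ u = incl F x :=
  ⟨ψ.symm (incl F x), by rw [mem_augIdeal, ← hψ, ψ.apply_symm_apply, augmentation_incl],
    ψ.apply_symm_apply _⟩

/-- In H the element b₄ = [b₀,[b₀,b₁]] is a double commutator outside ω⁴, as the entry (0, 4), of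
weight three, is nonzero. -/
theorem not_twoStepType_threeStepType {ε : F}
    (hψ : ∀ u, augmentation F H (ψ u) = augmentation F L u)
    (hL : IsTwoStepType F L) (hH : IsThreeStepType F H ε) : False := by
  obtain ⟨c, hc⟩ := hL
  have h3 : ∀ x y z : L, ⁅x, ⁅y, z⁆⁆ = 0 := fun x => by
    refine fun y z => hc.lie_mem (LinearMap.ker (LieAlgebra.ad F L x)) ?_ y z
    obtain ⟨-, -, -, h3, h4⟩ := hc.lie_basis x
    simp [h3, h4]
  obtain ⟨b, hb, f, hf, hw⟩ := exists_rep_threeStepType hH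
  obtain ⟨u, hu, hu'⟩ := exists_map_eq_incl hψ (b 0)
  obtain ⟨v, hv, hv'⟩ := exists_map_eq_incl hψ (b 1)
  have key : incl F (b 4) ∈ augIdeal F H ^ 4 := by
    rw [← hb.h02, ← hb.h01, incl_lie_eq_lie, incl_lie_eq_lie, ← hu', ← hv', ← algEquiv_lie,
      ← algEquiv_lie, map_mem_augIdeal_pow_iff hψ]
    exact lie_lie_mem h3 hu hu hv
  have := hw 4 _ key 0 4 (by decide)
  rw [hf] at this
  simp at this

theorem not_freeThreeStepType_filiformType {ε : F}
    (hψ : ∀ u, augmentation F H (ψ u) = augmentation F L u)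
    (hL : IsFreeThreeStepType F L) (hH : IsFiliformType F H ε) : False := by
  obtain ⟨c, hc⟩ := hL
  have h3 : ∀ x y z w : L, ⁅x, ⁅y, ⁅z, w⁆⁆⁆ = 0 := fun x y => by
    refine fun z w => hc.lie_mem
      (LinearMap.ker (LieAlgebra.ad F L x ∘ₗ LieAlgebra.ad F L y)) ?_ z w
    obtain ⟨-, -, h2, h3, h4⟩ := hc.lie_basis y
    obtain ⟨-, -, -, h3', h4'⟩ := hc.lie_basis x
    simp [h2, h3, h4, h3', h4']
  obtain ⟨b, hb, f, hf, hw⟩ := exists_rep_filiformType hH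
  obtain ⟨u, hu, hu'⟩ := exists_map_eq_incl hψ (b 0)
  obtain ⟨v, hv, hv'⟩ := exists_map_eq_incl hψ (b 1)
  have key : incl F (b 4) ∈ augIdeal F H ^ 5 := by
    rw [← hb.h03, ← hb.h02, ← hb.h01, incl_lie_eq_lie, incl_lie_eq_lie, incl_lie_eq_lie, ← hu',
      ← hv', ← algEquiv_lie, ← algEquiv_lie, ← algEquiv_lie, map_mem_augIdeal_pow_iff hψ]
    exact lie_lie_lie_mem h3 hu hu hu hv
  have := hw 5 _ key 0 4 (by decide)
  rw [hf] at this
  simp at this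

end Obstructions
end UniversalEnvelopingAlgebra

/-! ### Separating the two filiform algebras. -/

section LieExpansions

variable {F M : Type*} [Field F] [LieRing M] [LieAlgebra F M]

theorem lie_add_smul_add_smul (γ δ α β : F) (e₀ e₁ r s : M) :
    ⁅γ • e₀ + δ • e₁ + r, α • e₀ + β • e₁ + s⁆ = (γ * β - δ * α) • ⁅e₀, e₁⁆ +
      (⁅γ • e₀ + δ • e₁, s⁆ + ⁅r, α • e₀ + β • e₁ + s⁆) := by
  rw [add_lie, lie_add, add_assoc]
  congr 1
  have e10 : ⁅e₁, e₀⁆ = -⁅e₀, e₁⁆ := (lie_skew _ _).symm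
  simp only [add_lie, lie_add, smul_lie, lie_smul, lie_self, e10]
  module

theorem lie_smul_add_of_add_smul (k α β : F) (e₀ e₁ e₂ s t : M) :
    ⁅α • e₀ + β • e₁ + s, k • e₂ + t⁆ = (k * α) • ⁅e₀, e₂⁆ + ((k * β) • ⁅e₁, e₂⁆ +
      (⁅s, k • e₂⁆ + ⁅α • e₀ + β • e₁ + s, t⁆)) := by
  rw [lie_add]
  simp only [add_lie, smul_lie, lie_smul]
  module

/-- Grouped by depth for e₀, e₁ ∈ ω and r, s ∈ ω²: after the leading bracket come the terms linear
in r or s, in ω⁴, and the final parenthesis is in ω⁵. The linear terms are exactly those that the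
functional `q` for `L_{5,6}` kills. -/
theorem lie_lie_expand (β γ δ : F) (e₀ e₁ r s : M) :
    ⁅β • e₁ + s, ⁅γ • e₀ + δ • e₁ + r, β • e₁ + s⁆⁆ =
      (β * (γ * β)) • ⁅e₁, ⁅e₀, e₁⁆⁆ + (β * γ) • (⁅s, ⁅e₀, e₁⁆⁆ + ⁅e₁, ⁅e₀, s⁆⁆) +
      (β * δ) • ⁅e₁, ⁅e₁, s⁆⁆ - (β * β) • ⁅e₁, ⁅e₁, r⁆⁆ +
      (⁅β • e₁, ⁅r, s⁆⁆ + ⁅s, γ • ⁅e₀, s⁆ + δ • ⁅e₁, s⁆ - β • ⁅e₁, r⁆ + ⁅r, s⁆⁆) := by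
  have hr1 : ⁅r, e₁⁆ = -⁅e₁, r⁆ := (lie_skew _ _).symm
  simp only [add_lie, lie_add, lie_sub, smul_lie, lie_smul, lie_self, hr1, lie_neg,
    lie_zero, smul_zero]
  module

end LieExpansions

namespace UniversalEnvelopingAlgebra

section FiliformObstruction

attribute [local instance] LieRing.ofAssociativeRing

variable {F L H : Type*} [Field F] [LieRing L] [LieAlgebra F L] [LieRing H] [LieAlgebra F H]
  {ψ : UniversalEnvelopingAlgebra F L ≃ₐ[F] UniversalEnvelopingAlgebra F H}

/-- The enveloping algebra of `L_{5,6}` in characteristic different from two has no generators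
`X`, `Y` with `⁅Y, ⁅X, Y⁆⁆ = 0`. -/
theorem lie_lie_ne_zero_of_filiformType {b : Module.Basis (Fin 5) F H}
    (hb : HasBrackets b (b 2) (b 3) (b 4) 0 (b 4) 0 0 0 0 0)
    {p q : UniversalEnvelopingAlgebra F H →ₗ[F] F}
    (hp : ∀ u ∈ augIdeal F H ^ 4, p u = 0) (hp3 : p (incl F (b 3)) ≠ 0)
    (hq : ∀ u ∈ augIdeal F H ^ 5, q u = 0) (hq4 : q (incl F (b 4)) ≠ 0)
    (hq0 : ∀ u ∈ augIdeal F H ^ 2,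
      q (⁅u, incl F (b 2)⁆ + ⁅incl F (b 1), ⁅incl F (b 0), u⁆⁆) = 0)
    (hq1 : ∀ u ∈ augIdeal F H ^ 2, q ⁅incl F (b 1), ⁅incl F (b 1), u⁆⁆ = 0)
    {γ δ α β : F} {r s : UniversalEnvelopingAlgebra F H} (hr : r ∈ augIdeal F H ^ 2)
    (hs : s ∈ augIdeal F H ^ 2) (hdet : γ * β - δ * α ≠ 0)
    (h : ⁅α • incl F (b 0) + β • incl F (b 1) + s,
      ⁅γ • incl F (b 0) + δ • incl F (b 1) + r, α • incl F (b 0) + β • incl F (b 1) + s⁆⁆ = 0) :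
    False := by
  have e01 : ⁅incl F (b 0), incl F (b 1)⁆ = incl F (b 2) := by rw [← incl_lie_eq_lie, hb.h01]
  have e02 : ⁅incl F (b 0), incl F (b 2)⁆ = incl F (b 3) := by rw [← incl_lie_eq_lie, hb.h02]
  have e12 : ⁅incl F (b 1), incl F (b 2)⁆ = incl F (b 4) := by rw [← incl_lie_eq_lie, hb.h12]
  have m0 := incl_mem_augIdeal_pow_one (F := F) (b 0)
  have m1 := incl_mem_augIdeal_pow_one (F := F) (b 1)
  have m2 : incl F (b 2) ∈ augIdeal F H ^ 2 := hb.h01 ▸ incl_lie_mem_augIdeal_pow _ m1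
  have m3 : incl F (b 3) ∈ augIdeal F H ^ 3 := hb.h02 ▸ incl_lie_mem_augIdeal_pow _ m2
  have m4 : incl F (b 4) ∈ augIdeal F H ^ 4 := hb.h03 ▸ incl_lie_mem_augIdeal_pow _ m3
  set e0 := incl F (b 0) with he0
  set e1 := incl F (b 1) with he1
  have hX : ∀ a c : F, a • e0 + c • e1 ∈ augIdeal F H ^ 1 := fun a c =>
    Submodule.add_mem _ (Submodule.smul_mem _ _ m0) (Submodule.smul_mem _ _ m1)
  -- Modulo ω⁴ the double commutator is det·α·b₃, which `p` detects.
  have hα : α = 0 := by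
    have hC : ⁅γ • e0 + δ • e1 + r, α • e0 + β • e1 + s⁆ = (γ * β - δ * α) • incl F (b 2) +
        (⁅γ • e0 + δ • e1, s⁆ + ⁅r, α • e0 + β • e1 + s⁆) := by
      rw [← e01]
      exact lie_add_smul_add_smul γ δ α β e0 e1 r s
    set t := ⁅γ • e0 + δ • e1, s⁆ + ⁅r, α • e0 + β • e1 + s⁆ with ht
    have mt : t ∈ augIdeal F H ^ 3 := Submodule.add_mem _
      (lie_mem_augIdeal_pow (i := 1) (j := 2) (hX _ _) hs)
      (lie_mem_augIdeal_pow (i := 2) (j := 1) hr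
        (Submodule.add_mem _ (hX _ _) (augIdeal_pow_le le_rfl (by norm_num) hs)))
    have hE : ⁅α • e0 + β • e1 + s, (γ * β - δ * α) • incl F (b 2) + t⁆ =
        ((γ * β - δ * α) * α) • incl F (b 3) + (((γ * β - δ * α) * β) • incl F (b 4) +
        (⁅s, (γ * β - δ * α) • incl F (b 2)⁆ + ⁅α • e0 + β • e1 + s, t⁆)) := by
      rw [← e02, ← e12]
      exact lie_smul_add_of_add_smul _ α β e0 e1 _ s t
    rw [hC, hE] at h
    have := congrArg p h
    rw [map_add, hp (_ + _), map_smul, add_zero, map_zero, smul_eq_mul] at this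
    · simpa [hdet, hp3] using this
    · refine Submodule.add_mem _ (Submodule.smul_mem _ _ m4) (Submodule.add_mem _
        (lie_mem_augIdeal_pow (i := 2) (j := 2) hs (Submodule.smul_mem _ _ m2))
        (lie_mem_augIdeal_pow (i := 1) (j := 3) (Submodule.add_mem _ (hX _ _) ?_) mt))
      exact augIdeal_pow_le le_rfl (by norm_num) hs
  subst hα
  have hγβ : γ * β ≠ 0 := by simpa using hdet
  rw [zero_smul, zero_add] at h
  have hE : ⁅β • e1 + s, ⁅γ • e0 + δ • e1 + r, β • e1 + s⁆⁆ =
      (β * (γ * β)) • incl F (b 4) +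
      (β * γ) • (⁅s, incl F (b 2)⁆ + ⁅e1, ⁅e0, s⁆⁆) +
      (β * δ) • ⁅e1, ⁅e1, s⁆⁆ - (β * β) • ⁅e1, ⁅e1, r⁆⁆ +
      (⁅β • e1, ⁅r, s⁆⁆ + ⁅s, γ • ⁅e0, s⁆ + δ • ⁅e1, s⁆ - β • ⁅e1, r⁆ + ⁅r, s⁆⁆) := by
    rw [← e12, ← e01]
    exact lie_lie_expand β γ δ e0 e1 r s
  rw [hE] at h
  have mrs : ⁅r, s⁆ ∈ augIdeal F H ^ 4 := lie_mem_augIdeal_pow (i := 2) (j := 2) hr hs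
  have mrest : ⁅β • e1, ⁅r, s⁆⁆ + ⁅s, γ • ⁅e0, s⁆ + δ • ⁅e1, s⁆ - β • ⁅e1, r⁆ + ⁅r, s⁆⁆ ∈
      augIdeal F H ^ 5 := by
    refine Submodule.add_mem _
      (lie_mem_augIdeal_pow (i := 1) (j := 4) (Submodule.smul_mem _ _ m1) mrs)
      (lie_mem_augIdeal_pow (i := 2) (j := 3) hs (Submodule.add_mem _ (Submodule.sub_mem _
        (Submodule.add_mem _ (Submodule.smul_mem _ _ ?_) (Submodule.smul_mem _ _ ?_))
        (Submodule.smul_mem _ _ ?_)) (augIdeal_pow_le (by norm_num) (by norm_num) mrs)))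
    · exact lie_mem_augIdeal_pow (i := 1) (j := 2) m0 hs
    · exact lie_mem_augIdeal_pow (i := 1) (j := 2) m1 hs
    · exact lie_mem_augIdeal_pow (i := 1) (j := 2) m1 hr
  -- With α = 0, applying `q` leaves only βγβ·q(b₄), which is nonzero because γβ is now the
  -- determinant.
  have := congrArg q h
  rw [map_add, hq _ mrest, map_sub, map_add, map_add, map_smul, map_smul, map_smul, map_smul,
    hq0 s hs, hq1 s hs, hq1 r hr, map_zero] at this
  have hβ : β ≠ 0 := right_ne_zero_of_mul hγβ
  simp [hq4, hβ, left_ne_zero_of_mul hγβ] at this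

theorem not_filiformType (h2 : (2 : F) ≠ 0)
    (hψ : ∀ u, augmentation F H (ψ u) = augmentation F L u)
    (hL : IsFiliformType F L 0) (hH : IsFiliformType F H 1) : False := by
  obtain ⟨c, hc⟩ := hL
  rw [zero_smul] at hc
  obtain ⟨b, hb, p, q, hp, hp3, hq, hq4, hq0, hq1⟩ := exists_functional_filiformType h2 hH
  have m2 : incl F (b 2) ∈ augIdeal F H ^ 2 :=
    hb.h01 ▸ incl_lie_mem_augIdeal_pow _ (incl_mem_augIdeal_pow_one _)
  have m3 : incl F (b 3) ∈ augIdeal F H ^ 2 :=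
    hb.h02 ▸ incl_lie_mem_augIdeal_pow _ (incl_mem_augIdeal_pow_one _)
  have m4 : incl F (b 4) ∈ augIdeal F H ^ 2 :=
    hb.h03 ▸ incl_lie_mem_augIdeal_pow _ (incl_mem_augIdeal_pow_one _)
  have dec : ∀ x : L, ∃ a d : F, ∃ r ∈ augIdeal F H ^ 2,
      ψ (incl F x) = a • incl F (b 0) + d • incl F (b 1) + r := fun x => by
    obtain ⟨y, r, hr, hy⟩ := exists_eq_incl_add (u := ψ (incl F x)) (by
      rw [mem_augIdeal, hψ, augmentation_incl])
    refine ⟨b.repr y 0, b.repr y 1, b.repr y 2 • incl F (b 2) + b.repr y 3 • incl F (b 3) +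
      b.repr y 4 • incl F (b 4) + r, Submodule.add_mem _ (Submodule.add_mem _ (Submodule.add_mem _
      (Submodule.smul_mem _ _ m2) (Submodule.smul_mem _ _ m3)) (Submodule.smul_mem _ _ m4)) hr, ?_⟩
    rw [hy]
    conv_lhs => rw [← b.sum_repr y, Fin.sum_univ_five]
    simp only [map_add, map_smul]
    abel
  obtain ⟨γ, δ, r, hr, hX⟩ := dec (c 0)
  obtain ⟨α, β, s, hs, hY⟩ := dec (c 1)
  -- The images of the two generators stay independent modulo ω², since `ψ` preserves ω² and the
  -- first two coordinates on L vanish on brackets. This is what makes the determinant nonzero.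
  have indep : ∀ m n : F, m * γ + n * α = 0 → m * δ + n * β = 0 → m = 0 ∧ n = 0 := by
    intro m n h0 h1
    have hmem : incl F (m • c 0 + n • c 1) ∈ augIdeal F L ^ 2 := by
      rw [← map_mem_augIdeal_pow_iff hψ, map_add, map_smul, map_smul, map_add, map_smul, map_smul,
        hX, hY]
      have : m • (γ • incl F (b 0) + δ • incl F (b 1) + r) +
          n • (α • incl F (b 0) + β • incl F (b 1) + s) = (m * γ + n * α) • incl F (b 0) +
          (m * δ + n * β) • incl F (b 1) + (m • r + n • s) := by module
      rw [this, h0, h1, zero_smul, zero_smul, zero_add, zero_add]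
      exact Submodule.add_mem _ (Submodule.smul_mem _ _ hr) (Submodule.smul_mem _ _ hs)
    have k0 := mem_of_incl_mem_augIdeal_sq (D := LinearMap.ker (c.coord 0))
      (hc.lie_mem _ (by simp)) hmem
    have k1 := mem_of_incl_mem_augIdeal_sq (D := LinearMap.ker (c.coord 1))
      (hc.lie_mem _ (by simp)) hmem
    constructor
    · simpa using k0
    · simpa using k1
  refine lie_lie_ne_zero_of_filiformType hb hp hp3 hq hq4 hq0 hq1 (γ := γ) (δ := δ)
    (α := α) (β := β) hr hs (fun hdet => ?_) ?_
  · obtain ⟨hβ, hδ⟩ := indep β (-δ) (by linear_combination hdet) (by ring)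
    obtain ⟨hα, hγ⟩ := indep α (-γ) (by ring) (by linear_combination -hdet)
    rw [neg_eq_zero] at hδ hγ
    exact one_ne_zero (indep 1 0 (by simp [hγ]) (by simp [hδ])).1
  · rw [← hX, ← hY, ← algEquiv_lie, ← algEquiv_lie, ← incl_lie_eq_lie, ← incl_lie_eq_lie, hc.h01,
      hc.h12, map_zero, map_zero]

end FiliformObstruction
end UniversalEnvelopingAlgebra

/-! ### Exceptional isomorphisms in characteristic two. -/

namespace UniversalEnvelopingAlgebra

section CharTwo

attribute [local instance] LieRing.ofAssociativeRing

variable {F L H A : Type*} [Field F] [LieRing L] [LieAlgebra F L] [LieRing H] [LieAlgebra F H]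
  [Ring A] [Algebra F A]

theorem algHom_ext_basis {ι : Type*} (b : Module.Basis ι F L)
    {f g : UniversalEnvelopingAlgebra F L →ₐ[F] A} (h : ∀ i, f (incl F (b i)) = g (incl F (b i))) :
    f = g :=
  algHom_ext_incl fun x => LinearMap.congr_fun
    (b.ext h : f.toLinearMap ∘ₗ incl F = g.toLinearMap ∘ₗ incl F) x

theorem nonempty_algEquiv_of_basis (c : Module.Basis (Fin 5) F L) (b : Module.Basis (Fin 5) F H)
    (f : UniversalEnvelopingAlgebra F L →ₐ[F] UniversalEnvelopingAlgebra F H)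
    (g : UniversalEnvelopingAlgebra F H →ₐ[F] UniversalEnvelopingAlgebra F L)
    (hgf : ∀ i, g (f (incl F (c i))) = incl F (c i))
    (hfg : ∀ i, f (g (incl F (b i))) = incl F (b i)) :
    Nonempty (UniversalEnvelopingAlgebra F L ≃ₐ[F] UniversalEnvelopingAlgebra F H) :=
  ⟨AlgEquiv.ofAlgHom f g (algHom_ext_basis b hfg) (algHom_ext_basis c hgf)⟩

/-- The two sides differ by twice xyx - yx². -/
theorem mul_self_lie (h : ∀ u : A, u + u = 0) (x y : A) : ⁅x * x, y⁆ = ⁅x, ⁅x, y⁆⁆ := by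
  simp only [LieRing.of_associative_ring_bracket]
  have := h (x * y * x - y * x * x)
  rw [← sub_eq_zero]
  rw [← this]
  noncomm_ring

theorem add_self_eq_zero_of_charP_two (F : Type*) [Field F] [CharP F 2] [Algebra F A] (u : A) :
    u + u = 0 := by
  rw [← two_smul F, CharTwo.two_eq_zero, zero_smul]

theorem neg_eq_self_of_charP_two (F : Type*) [Field F] [CharP F 2] [Algebra F A] (u : A) :
    -u = u :=
  neg_eq_of_add_eq_zero_left (add_self_eq_zero_of_charP_two F u)

theorem sq_incl_lie [CharP F 2] (x y : L) :
    ⁅incl F x * incl F x, incl F y⁆ = incl F ⁅x, ⁅x, y⁆⁆ := by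
  rw [mul_self_lie (add_self_eq_zero_of_charP_two F), ← incl_lie_eq_lie, ← incl_lie_eq_lie]

theorem lie_sq_incl [CharP F 2] (x y : L) :
    ⁅incl F y, incl F x * incl F x⁆ = -incl F ⁅x, ⁅x, y⁆⁆ := by
  rw [← lie_skew, sq_incl_lie]

/-- The element b₃ + b₀² commutes with b₁: both b₃ and b₀² contribute b₄ up to opposite signs, the
second through [b₀,[b₀,b₁]]. Hence it can play the role of the central `c 3`. -/
theorem nonempty_algEquiv_threeStepType [CharP F 2] (hL : IsThreeStepType F L 0)
    (hH : IsThreeStepType F H 1) :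
    Nonempty (UniversalEnvelopingAlgebra F L ≃ₐ[F] UniversalEnvelopingAlgebra F H) := by
  obtain ⟨c, hc⟩ := hL
  obtain ⟨b, hb⟩ := hH
  rw [zero_smul] at hc
  rw [one_smul] at hb
  obtain ⟨f, hf⟩ := exists_algHom_of_hasBrackets (A := UniversalEnvelopingAlgebra F H) hc
    ![incl F (b 0), incl F (b 1), incl F (b 2), incl F (b 3) + incl F (b 0) * incl F (b 0),
      incl F (b 4)] (by
      obtain ⟨h01, h02, h03, h04, h12, h13, h14, h23, h24, h34⟩ := hb
      intro g
      constructor <;>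
      simp [g, lie_add, add_lie, lie_sq_incl, sq_incl_lie, ← incl_lie_eq_lie, h01, h02, h03, h04,
        h12, h13, h14, h23, h24, h34])
  obtain ⟨g, hg⟩ := exists_algHom_of_hasBrackets (A := UniversalEnvelopingAlgebra F L) hb
    ![incl F (c 0), incl F (c 1), incl F (c 2), incl F (c 3) - incl F (c 0) * incl F (c 0),
      incl F (c 4)] (by
      obtain ⟨h01, h02, h03, h04, h12, h13, h14, h23, h24, h34⟩ := hc
      intro g
      constructor <;>
      simp [g, lie_sub, sub_lie, lie_sq_incl, sq_incl_lie, ← incl_lie_eq_lie, h01, h02, h03, h04,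
        h12, h13, h14, h23, h24, h34])
  refine nonempty_algEquiv_of_basis c b f g (fun i => ?_) (fun i => ?_)
  · rw [hf]
    fin_cases i <;> simp [hg]
  · rw [hg]
    fin_cases i <;> simp [hf]

/-- Adding b₀² to b₁ changes [b₁, b₂] by [b₀,[b₀,b₂]] = b₄, which cancels it since 2 = 0; the
bracket with b₀ is unaffected. -/
theorem nonempty_algEquiv_filiformType [CharP F 2] (hL : IsFiliformType F L 0)
    (hH : IsFiliformType F H 1) :
    Nonempty (UniversalEnvelopingAlgebra F L ≃ₐ[F] UniversalEnvelopingAlgebra F H) := by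
  obtain ⟨c, hc⟩ := hL
  obtain ⟨b, hb⟩ := hH
  rw [zero_smul] at hc
  rw [one_smul] at hb
  obtain ⟨f, hf⟩ := exists_algHom_of_hasBrackets (A := UniversalEnvelopingAlgebra F H) hc
    ![incl F (b 0), incl F (b 1) + incl F (b 0) * incl F (b 0), incl F (b 2), incl F (b 3),
      incl F (b 4)] (by
      obtain ⟨h01, h02, h03, h04, h12, h13, h14, h23, h24, h34⟩ := hb
      intro g
      constructor <;>
      simp [g, lie_add, add_lie, lie_sq_incl, sq_incl_lie, ← incl_lie_eq_lie, h01, h02, h03, h04,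
        h12, h13, h14, h23, h24, h34, add_self_eq_zero_of_charP_two F])
  obtain ⟨g, hg⟩ := exists_algHom_of_hasBrackets (A := UniversalEnvelopingAlgebra F L) hb
    ![incl F (c 0), incl F (c 1) - incl F (c 0) * incl F (c 0), incl F (c 2), incl F (c 3),
      incl F (c 4)] (by
      obtain ⟨h01, h02, h03, h04, h12, h13, h14, h23, h24, h34⟩ := hc
      intro g
      constructor <;>
      simp [g, lie_sub, sub_lie, lie_sq_incl, sq_incl_lie, ← incl_lie_eq_lie, h01, h02, h03, h04,
        h12, h13, h14, h23, h24, h34, neg_eq_self_of_charP_two F])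
  refine nonempty_algEquiv_of_basis c b f g (fun i => ?_) (fun i => ?_)
  · rw [hf]
    fin_cases i <;> simp [hg]
  · rw [hg]
    fin_cases i <;> simp [hf]

end CharTwo
end UniversalEnvelopingAlgebra

/-! ### Lower central series and generators. -/

section LowerCentral

variable (F L : Type*) [Field F] [LieRing L] [LieAlgebra F L]

/-- The terms of the lower central series as subspaces. -/
def lowerCentral (n : ℕ) : Submodule F L :=
  (LieModule.lowerCentralSeries F L L n).toSubmodule

variable {F L}

theorem lie_mem_lowerCentral {n : ℕ} (x : L) {m : L} (hm : m ∈ lowerCentral F L n) :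
    ⁅x, m⁆ ∈ lowerCentral F L (n + 1) := by
  change _ ∈ LieModule.lowerCentralSeries F L L (n + 1)
  rw [LieModule.lowerCentralSeries_succ]
  exact LieSubmodule.lie_mem_lie (LieSubmodule.mem_top x) hm

theorem lie_mem_lowerCentral' {n : ℕ} {m : L} (hm : m ∈ lowerCentral F L n) (x : L) :
    ⁅m, x⁆ ∈ lowerCentral F L (n + 1) := by
  rw [← lie_skew]
  exact Submodule.neg_mem _ (lie_mem_lowerCentral x hm)

theorem lowerCentral_succ_le_iff {n : ℕ} {P : Submodule F L} :
    lowerCentral F L (n + 1) ≤ P ↔ ∀ x : L, ∀ m ∈ lowerCentral F L n, ⁅x, m⁆ ∈ P := by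
  refine ⟨fun h x m hm => h (lie_mem_lowerCentral x hm), fun h => ?_⟩
  rw [lowerCentral, LieModule.lowerCentralSeries_succ,
    LieSubmodule.lieIdeal_oper_eq_linear_span', Submodule.span_le]
  rintro _ ⟨x, -, m, hm, rfl⟩
  exact h x m hm

theorem lowerCentral_one : lowerCentral F L 1 = derivedSubmodule F L := by
  refine le_antisymm
    (lowerCentral_succ_le_iff.2 fun x m _ => lie_mem_derivedSubmodule x m) ?_
  rw [derivedSubmodule, Submodule.span_le]
  rintro _ ⟨x, y, rfl⟩
  exact lie_mem_lowerCentral (n := 0) x trivial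

theorem lowerCentral_succ_le (n : ℕ) : lowerCentral F L (n + 1) ≤ lowerCentral F L n := by
  induction n with
  | zero => exact le_top
  | succ n ih => exact lowerCentral_succ_le_iff.2 fun x m hm => lie_mem_lowerCentral x (ih hm)

theorem lie_mem_lowerCentral_of_mem_one {n : ℕ} {d m : L} (hd : d ∈ lowerCentral F L 1)
    (hm : m ∈ lowerCentral F L n) : ⁅d, m⁆ ∈ lowerCentral F L (n + 2) := by
  rw [lowerCentral_one] at hd
  induction hd using Submodule.span_induction with
  | zero => simp
  | add x y _ _ hx hy => rw [add_lie]; exact Submodule.add_mem _ hx hy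
  | smul a x _ hx => rw [smul_lie]; exact Submodule.smul_mem _ a hx
  | mem x hx =>
    obtain ⟨y, z, rfl⟩ := hx
    rw [lie_lie]
    exact Submodule.sub_mem _ (lie_mem_lowerCentral _ (lie_mem_lowerCentral _ hm))
      (lie_mem_lowerCentral _ (lie_mem_lowerCentral _ hm))

/-- A lower central series that stops descending is constant from there on, and nilpotency forces
the constant value to be zero. -/
theorem lowerCentral_eq_bot [LieRing.IsNilpotent L] {n : ℕ}
    (h : lowerCentral F L n ≤ lowerCentral F L (n + 1)) : lowerCentral F L n = ⊥ := by
  obtain ⟨k, hk⟩ := (LieModule.isNilpotent_iff F L L).1 ‹_›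
  have hk' : lowerCentral F L k = ⊥ := by rw [lowerCentral, hk]; rfl
  have key : ∀ j, lowerCentral F L n ≤ lowerCentral F L (n + j) := fun j => by
    induction j with
    | zero => exact le_rfl
    | succ j ih =>
      refine h.trans (lowerCentral_succ_le_iff.2 fun x m hm => ?_)
      exact lie_mem_lowerCentral x (ih hm)
  have hanti : Antitone (lowerCentral F L) := antitone_nat_of_succ_le lowerCentral_succ_le
  exact eq_bot_iff.2 (((key k).trans (hanti (Nat.le_add_left k n))).trans hk'.le)

theorem finrank_lowerCentral_succ_lt [LieRing.IsNilpotent L] [Module.Finite F L] {n : ℕ}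
    (h : lowerCentral F L n ≠ ⊥) :
    Module.finrank F (lowerCentral F L (n + 1)) < Module.finrank F (lowerCentral F L n) :=
  Submodule.finrank_lt_finrank_of_lt
    (lt_of_le_of_ne (lowerCentral_succ_le n) fun e => h (lowerCentral_eq_bot e.ge))

/-- A family of vectors spanning the Lie algebra modulo its derived algebra. -/
def GeneratesModDerived (F : Type*) {L ι : Type*} [Field F] [LieRing L] [LieAlgebra F L]
    (a : ι → L) : Prop :=
  ∀ W : Submodule F L, lowerCentral F L 1 ≤ W → (∀ i, a i ∈ W) → W = ⊤

/-- The bracket induces a bilinear map on L/[L,L] and γₙ/γₙ₊₁ with values in γₙ₊₁/γₙ₊₂, whose image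
spans. Thus brackets of generators with generators of one layer generate the next layer. Indices
start with γ₀ = L. -/
theorem lowerCentral_succ_le_of_generates {ι κ : Type*} {a : ι → L}
    (ha : GeneratesModDerived F a) {n : ℕ} {t : κ → L} (htn : ∀ j, t j ∈ lowerCentral F L n)
    (ht : ∀ W : Submodule F L, lowerCentral F L (n + 1) ≤ W → (∀ j, t j ∈ W) →
      lowerCentral F L n ≤ W)
    {P : Submodule F L} (hP : lowerCentral F L (n + 2) ≤ P) (h : ∀ i j, ⁅a i, t j⁆ ∈ P) :
    lowerCentral F L (n + 1) ≤ P := by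
  let W₁ : Submodule F L :=
    { carrier := {x | ∀ j, ⁅x, t j⁆ ∈ P}
      add_mem' := fun hx hy j => by rw [add_lie]; exact P.add_mem (hx j) (hy j)
      zero_mem' := fun j => by rw [zero_lie]; exact P.zero_mem
      smul_mem' := fun c x hx j => by rw [smul_lie]; exact P.smul_mem c (hx j) }
  have h₁ : W₁ = ⊤ := ha W₁ (fun d hd j => hP (lie_mem_lowerCentral_of_mem_one hd (htn j))) h
  let W₂ : Submodule F L :=
    { carrier := {m | ∀ x : L, ⁅x, m⁆ ∈ P}
      add_mem' := fun hx hy j => by rw [lie_add]; exact P.add_mem (hx j) (hy j)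
      zero_mem' := fun j => by rw [lie_zero]; exact P.zero_mem
      smul_mem' := fun c x hx j => by rw [lie_smul]; exact P.smul_mem c (hx j) }
  have h₂ : lowerCentral F L n ≤ W₂ := ht W₂ (fun m hm x => hP (lie_mem_lowerCentral x hm))
    fun j x => (h₁ ▸ Submodule.mem_top : x ∈ W₁) j
  exact lowerCentral_succ_le_iff.2 fun x m hm => h₂ hm x

theorem lowerCentral_one_le_of_generates {d : ℕ} {a : Fin d → L}
    (ha : GeneratesModDerived F a) {P : Submodule F L} (hP : lowerCentral F L 2 ≤ P)
    (h : ∀ i j, i < j → ⁅a i, a j⁆ ∈ P) : lowerCentral F L 1 ≤ P := by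
  refine lowerCentral_succ_le_of_generates (n := 0) ha (t := a) (fun _ => trivial)
    (fun W h1 h2 => (ha W h1 h2).ge) hP fun i j => ?_
  rcases lt_trichotomy i j with hij | rfl | hij
  · exact h i j hij
  · rw [lie_self]; exact P.zero_mem
  · rw [← lie_skew]; exact P.neg_mem (h j i hij)

theorem exists_generatesModDerived [Module.Finite F L] {d : ℕ}
    (hd : Module.finrank F (L ⧸ derivedSubmodule F L) = d) :
    ∃ a : Fin d → L, GeneratesModDerived F a := by
  let b := Module.finBasisOfFinrankEq F (L ⧸ derivedSubmodule F L) hd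
  choose a ha using fun i => Submodule.mkQ_surjective (derivedSubmodule F L) (b i)
  refine ⟨a, fun W h1 h2 => ?_⟩
  rw [lowerCentral_one] at h1
  have h3 : W.map (derivedSubmodule F L).mkQ = ⊤ := by
    rw [eq_top_iff, ← b.span_eq, Submodule.span_le]
    rintro _ ⟨i, rfl⟩
    exact ⟨a i, h2 i, ha i⟩
  rw [← sup_eq_right.2 h1, ← Submodule.comap_map_mkQ, h3, Submodule.comap_top]

/-- In dimension five, five spanning vectors form a basis; so in the classification only spanning is
checked, never independence. -/
theorem exists_basis_of_spans (hL : Module.finrank F L = 5) (v : Fin 5 → L)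
    (h : ∀ W : Submodule F L, (∀ i, v i ∈ W) → W = ⊤) :
    ∃ b : Module.Basis (Fin 5) F L, ⇑b = v := by
  have hs : ⊤ ≤ Submodule.span F (Set.range v) :=
    (h (Submodule.span F (Set.range v)) fun i => Submodule.subset_span ⟨i, rfl⟩).ge
  exact ⟨basisOfTopLeSpanOfCardEqFinrank v hs (by simp [hL]),
    coe_basisOfTopLeSpanOfCardEqFinrank v hs (by simp [hL])⟩

/-- In a subspace of relative dimension at most one, every vector is a multiple of a given vector
outside the smaller subspace. -/
theorem Submodule.exists_sub_smul_mem {V : Type*} [AddCommGroup V] [Module F V]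
    [Module.Finite F V] {P Q : Submodule F V} (hPQ : P ≤ Q)
    (hrank : Module.finrank F Q ≤ Module.finrank F P + 1) {e e' : V} (he : e ∈ Q) (heP : e ∉ P)
    (he' : e' ∈ Q) : ∃ k : F, e' - k • e ∈ P := by
  have hle : P ⊔ Submodule.span F {e} ≤ Q :=
    sup_le hPQ ((Submodule.span_singleton_le_iff_mem _ _).2 he)
  have hlt : P < P ⊔ Submodule.span F {e} := lt_of_le_of_ne le_sup_left fun h =>
    heP (h ▸ Submodule.mem_sup_right (Submodule.mem_span_singleton_self e))
  have hr := Submodule.finrank_lt_finrank_of_lt hlt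
  have heq := Submodule.eq_of_le_of_finrank_le hle (by omega)
  rw [← heq] at he'
  obtain ⟨p, hp, q, hq, rfl⟩ := Submodule.mem_sup.1 he'
  obtain ⟨k, rfl⟩ := Submodule.mem_span_singleton.1 hq
  exact ⟨k, by rwa [add_sub_cancel_right]⟩

end LowerCentral

/-! ### Classification with two generators. -/

section ClassificationTwo

variable {F L : Type*} [Field F] [LieRing L] [LieAlgebra F L]

theorem GeneratesModDerived.pair_iff {a b : L} : GeneratesModDerived F ![a, b] ↔
    ∀ W : Submodule F L, lowerCentral F L 1 ≤ W → a ∈ W → b ∈ W → W = ⊤ := by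
  simp [GeneratesModDerived, Fin.forall_fin_two]

theorem lie_mem_lowerCentral_one (a b : L) : ⁅a, b⁆ ∈ lowerCentral F L 1 :=
  lie_mem_lowerCentral (n := 0) a trivial

theorem lie_lie_mem_lowerCentral_two (a b c : L) : ⁅a, ⁅b, c⁆⁆ ∈ lowerCentral F L 2 :=
  lie_mem_lowerCentral a (lie_mem_lowerCentral_one b c)

theorem lie_lie_lie_mem_lowerCentral_three (a b c d : L) : ⁅a, ⁅b, ⁅c, d⁆⁆⁆ ∈ lowerCentral F L 3 :=
  lie_mem_lowerCentral a (lie_lie_mem_lowerCentral_two b c d)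

namespace GeneratesModDerived

variable {a b : L} {W : Submodule F L}

theorem pair_lowerCentral_one_le (h : GeneratesModDerived F ![a, b])
    (hW : lowerCentral F L 2 ≤ W) (hc : ⁅a, b⁆ ∈ W) : lowerCentral F L 1 ≤ W := by
  refine lowerCentral_one_le_of_generates h hW fun i j hij => ?_
  fin_cases i <;> fin_cases j <;> first | exact absurd hij (by decide) | exact hc

theorem pair_lowerCentral_two_le (h : GeneratesModDerived F ![a, b])
    (hW : lowerCentral F L 3 ≤ W) (hd : ⁅a, ⁅a, b⁆⁆ ∈ W) (he : ⁅b, ⁅a, b⁆⁆ ∈ W) :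
    lowerCentral F L 2 ≤ W := by
  refine lowerCentral_succ_le_of_generates (n := 1) h (t := ![⁅a, b⁆])
    (fun j => ?_) (fun W' h1 h2 => h.pair_lowerCentral_one_le h1 (h2 0)) hW fun i j => ?_
  · fin_cases j; exact lie_mem_lowerCentral_one a b
  · fin_cases j; fin_cases i
    · exact hd
    · exact he

theorem pair_lowerCentral_three_le (h : GeneratesModDerived F ![a, b])
    (hb : ⁅b, ⁅a, b⁆⁆ ∈ lowerCentral F L 3) (hW : lowerCentral F L 4 ≤ W)
    (he : ⁅a, ⁅a, ⁅a, b⁆⁆⁆ ∈ W) : lowerCentral F L 3 ≤ W := by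
  refine lowerCentral_succ_le_of_generates (n := 2) h (t := ![⁅a, ⁅a, b⁆⁆])
    (fun j => ?_) (fun W' h1 h2 => h.pair_lowerCentral_two_le h1 (h2 0) (h1 hb)) hW fun i j => ?_
  · fin_cases j; exact lie_lie_mem_lowerCentral_two a a b
  · fin_cases j; fin_cases i
    · exact he
    · change ⁅b, ⁅a, ⁅a, b⁆⁆⁆ ∈ W
      -- In the Jacobi identity the third term is a bracket of [a,b] with itself.
      have : ⁅b, ⁅a, ⁅a, b⁆⁆⁆ = ⁅a, ⁅b, ⁅a, b⁆⁆⁆ := by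
        rw [leibniz_lie b a ⁅a, b⁆, ← lie_skew b a, neg_lie, lie_self, neg_zero, zero_add]
      rw [this]
      exact hW (lie_mem_lowerCentral a hb)

end GeneratesModDerived

theorem eq_zero_of_mem_lowerCentral {n : ℕ} (h : lowerCentral F L n = ⊥) {x : L}
    (hx : x ∈ lowerCentral F L n) : x = 0 := by
  rwa [h, Submodule.mem_bot] at hx

theorem isFreeThreeStepType_of_generates (hL : Module.finrank F L = 5) {a b : L}
    (h : GeneratesModDerived F ![a, b]) (h3 : lowerCentral F L 3 = ⊥) :
    IsFreeThreeStepType F L := by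
  obtain ⟨v, hv⟩ := exists_basis_of_spans hL ![a, b, ⁅a, b⁆, ⁅a, ⁅a, b⁆⁆, ⁅b, ⁅a, b⁆⁆]
    fun W hW => by
      refine h W (h.pair_lowerCentral_one_le (h.pair_lowerCentral_two_le ?_ (hW 3) (hW 4)) (hW 2))
        (by simpa [Fin.forall_fin_two] using ⟨hW 0, hW 1⟩)
      rw [h3]; exact bot_le
  refine ⟨v, ?_⟩
  rw [hv]
  have z : ∀ x {y : L}, y ∈ lowerCentral F L 2 → ⁅x, y⁆ = 0 := fun x _ hy =>
    eq_zero_of_mem_lowerCentral h3 (lie_mem_lowerCentral x hy)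
  constructor
  · rfl
  · rfl
  · exact z _ (lie_lie_mem_lowerCentral_two _ _ _)
  · exact z _ (lie_lie_mem_lowerCentral_two _ _ _)
  · rfl
  · exact z _ (lie_lie_mem_lowerCentral_two _ _ _)
  · exact z _ (lie_lie_mem_lowerCentral_two _ _ _)
  · exact z _ (lie_lie_mem_lowerCentral_two _ _ _)
  · exact z _ (lie_lie_mem_lowerCentral_two _ _ _)
  · exact z _ (lie_lie_mem_lowerCentral_two _ _ _)

theorem isFiliformType_of_generates (hL : Module.finrank F L = 5) {a b : L} {ε : F}
    (h : GeneratesModDerived F ![a, b]) (h4 : lowerCentral F L 4 = ⊥)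
    (hb : ⁅b, ⁅a, b⁆⁆ = ε • ⁅a, ⁅a, ⁅a, b⁆⁆⁆) : IsFiliformType F L ε := by
  have hb3 : ⁅b, ⁅a, b⁆⁆ ∈ lowerCentral F L 3 :=
    hb ▸ Submodule.smul_mem _ _ (lie_lie_lie_mem_lowerCentral_three _ _ _ _)
  have z : ∀ x {y : L}, y ∈ lowerCentral F L 3 → ⁅x, y⁆ = 0 := fun x _ hy =>
    eq_zero_of_mem_lowerCentral h4 (lie_mem_lowerCentral x hy)
  obtain ⟨v, hv⟩ := exists_basis_of_spans hL
    ![a, b, ⁅a, b⁆, ⁅a, ⁅a, b⁆⁆, ⁅a, ⁅a, ⁅a, b⁆⁆⁆] fun W hW => by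
      have h3W := h.pair_lowerCentral_three_le hb3 (W := W) (by rw [h4]; exact bot_le) (hW 4)
      exact h W (h.pair_lowerCentral_one_le
        (h.pair_lowerCentral_two_le h3W (hW 3) (h3W hb3)) (hW 2))
        (by simpa [Fin.forall_fin_two] using ⟨hW 0, hW 1⟩)
  refine ⟨v, ?_⟩
  rw [hv]
  constructor
  · rfl
  · rfl
  · rfl
  · exact z _ (lie_lie_lie_mem_lowerCentral_three _ _ _ _)
  · exact hb
  · change ⁅b, ⁅a, ⁅a, b⁆⁆⁆ = 0
    rw [leibniz_lie b a ⁅a, b⁆, ← lie_skew b a, neg_lie, lie_self, neg_zero, zero_add]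
    exact z _ hb3
  · exact z _ (lie_lie_lie_mem_lowerCentral_three _ _ _ _)
  · exact eq_zero_of_mem_lowerCentral h4 (lie_mem_lowerCentral_of_mem_one
      (lie_mem_lowerCentral_one a b) (lie_lie_mem_lowerCentral_two a a b))
  · exact z _ (lie_lie_lie_mem_lowerCentral_three _ _ _ _)
  · exact z _ (lie_lie_lie_mem_lowerCentral_three _ _ _ _)

/-- The strict descent forces the dimensions 3, 2, 1, 0, so [a,[a,b]] spans γ₂/γ₃ and a multiple of
a can be subtracted from b to push [b,[a,b]] into the line γ₃. -/
theorem isFiliformType_of_lie_notMem [LieRing.IsNilpotent L] [Module.Finite F L]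
    (hL : Module.finrank F L = 5) (h1 : Module.finrank F (lowerCentral F L 1) = 3)
    {a b : L} (h : GeneratesModDerived F ![a, b]) (h3 : lowerCentral F L 3 ≠ ⊥)
    (hab : ⁅a, ⁅a, b⁆⁆ ∉ lowerCentral F L 3) :
    IsFiliformType F L 0 ∨ IsFiliformType F L 1 := by
  have hne : ∀ n ≤ 3, lowerCentral F L n ≠ ⊥ := fun n hn e => h3 <| eq_bot_iff.2 <|
    (antitone_nat_of_succ_le (lowerCentral_succ_le (F := F) (L := L)) hn).trans e.le
  have r1 := finrank_lowerCentral_succ_lt (hne 1 (by norm_num))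
  have r2 := finrank_lowerCentral_succ_lt (hne 2 (by norm_num))
  have r3 := finrank_lowerCentral_succ_lt h3
  simp only [Nat.reduceAdd] at r1 r2 r3
  have h4 : lowerCentral F L 4 = ⊥ := Submodule.finrank_eq_zero.1 (by omega)
  obtain ⟨k, hk⟩ := Submodule.exists_sub_smul_mem (P := lowerCentral F L 3)
    (Q := lowerCentral F L 2) (lowerCentral_succ_le 2) (by omega)
    (lie_lie_mem_lowerCentral_two a a b) hab (lie_lie_mem_lowerCentral_two b a b)
  set b' := b - k • a with hb'
  have hab' : ⁅a, b'⁆ = ⁅a, b⁆ := by rw [hb', lie_sub, lie_smul, lie_self, smul_zero, sub_zero]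
  have h' : GeneratesModDerived F ![a, b'] := GeneratesModDerived.pair_iff.2 fun W hW ha hb =>
    GeneratesModDerived.pair_iff.1 h W hW ha (by
      have := W.add_mem hb (W.smul_mem k ha)
      rwa [hb', sub_add_cancel] at this)
  have hb3 : ⁅b', ⁅a, b'⁆⁆ ∈ lowerCentral F L 3 := by
    rw [hab', hb', sub_lie, smul_lie]; exact hk
  have hspan : lowerCentral F L 3 ≤ Submodule.span F {⁅a, ⁅a, ⁅a, b'⁆⁆⁆} :=
    h'.pair_lowerCentral_three_le hb3 (by rw [h4]; exact bot_le)
      (Submodule.mem_span_singleton_self _)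
  obtain ⟨μ, hμ⟩ := Submodule.mem_span_singleton.1 (hspan hb3)
  by_cases hμ0 : μ = 0
  · subst hμ0
    exact Or.inl (isFiliformType_of_generates hL h' h4 hμ.symm)
  · right
    -- Scaling b by t multiplies [b,[a,b]] by t² but [a,[a,[a,b]]] only by t, so t = μ⁻¹ normalizes
    -- the coefficient without any square root.
    refine isFiliformType_of_generates hL (a := a) (b := μ⁻¹ • b')
      (GeneratesModDerived.pair_iff.2 fun W hW ha hb =>
        GeneratesModDerived.pair_iff.1 h' W hW ha ?_) h4 ?_
    · have := W.smul_mem μ hb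
      rwa [smul_smul, mul_inv_cancel₀ hμ0, one_smul] at this
    · simp only [lie_smul, smul_lie, ← hμ, smul_smul]
      rw [inv_mul_cancel₀ hμ0, mul_one, one_mul]

theorem classification_two_generators [LieRing.IsNilpotent L] [Module.Finite F L]
    (hL : Module.finrank F L = 5) (h1 : Module.finrank F (lowerCentral F L 1) = 3)
    {a b : L} (h : GeneratesModDerived F ![a, b]) :
    IsFreeThreeStepType F L ∨ IsFiliformType F L 0 ∨ IsFiliformType F L 1 := by
  by_cases h3 : lowerCentral F L 3 = ⊥
  · exact Or.inl (isFreeThreeStepType_of_generates hL h h3)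
  right
  by_cases hab : ⁅a, ⁅a, b⁆⁆ ∈ lowerCentral F L 3
  · have hba : ⁅b, ⁅b, a⁆⁆ ∉ lowerCentral F L 3 := fun hba => by
      refine h3 (eq_bot_iff.2 ?_)
      have h2 : lowerCentral F L 2 = ⊥ := by
        refine lowerCentral_eq_bot (h.pair_lowerCentral_two_le le_rfl hab ?_)
        rw [← lie_skew a b, lie_neg]
        exact Submodule.neg_mem _ hba
      exact (lowerCentral_succ_le 2).trans h2.le
    exact isFiliformType_of_lie_notMem hL h1 (GeneratesModDerived.pair_iff.2 fun W hW hb ha =>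
      GeneratesModDerived.pair_iff.1 h W hW ha hb) h3 hba
  · exact isFiliformType_of_lie_notMem hL h1 h h3 hab

end ClassificationTwo

/-! ### Classification with three generators. -/

section ClassificationThree

variable {F L : Type*} [Field F] [LieRing L] [LieAlgebra F L]

theorem GeneratesModDerived.triple_iff {a b c : L} : GeneratesModDerived F ![a, b, c] ↔
    ∀ W : Submodule F L, lowerCentral F L 1 ≤ W → a ∈ W → b ∈ W → c ∈ W → W = ⊤ := by
  simp [GeneratesModDerived, Fin.forall_fin_succ]

theorem GeneratesModDerived.triple_lowerCentral_one_le {a b c : L} {W : Submodule F L}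
    (h : GeneratesModDerived F ![a, b, c]) (hW : lowerCentral F L 2 ≤ W) (hab : ⁅a, b⁆ ∈ W)
    (hac : ⁅a, c⁆ ∈ W) (hbc : ⁅b, c⁆ ∈ W) : lowerCentral F L 1 ≤ W := by
  refine lowerCentral_one_le_of_generates h hW fun i j hij => ?_
  fin_cases i <;> fin_cases j <;>
    first | exact absurd hij (by decide) | exact hab | exact hac | exact hbc

theorem isTwoStepType_of_generates (hL : Module.finrank F L = 5) {x y z : L}
    (h : GeneratesModDerived F ![x, y, z]) (h2 : lowerCentral F L 2 = ⊥) (hyz : ⁅y, z⁆ = 0) :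
    IsTwoStepType F L := by
  obtain ⟨v, hv⟩ := exists_basis_of_spans hL ![x, y, z, ⁅x, y⁆, ⁅x, z⁆] fun W hW =>
    GeneratesModDerived.triple_iff.1 h W (h.triple_lowerCentral_one_le (by rw [h2]; exact bot_le)
      (hW 3) (hW 4) (by rw [hyz]; exact W.zero_mem)) (hW 0) (hW 1) (hW 2)
  refine ⟨v, ?_⟩
  rw [hv]
  have k : ∀ x y z : L, ⁅x, ⁅y, z⁆⁆ = 0 := fun x y z =>
    eq_zero_of_mem_lowerCentral h2 (lie_lie_mem_lowerCentral_two x y z)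
  constructor
  · rfl
  · rfl
  · exact k _ _ _
  · exact k _ _ _
  · exact hyz
  · exact k _ _ _
  · exact k _ _ _
  · exact k _ _ _
  · exact k _ _ _
  · exact k _ _ _

theorem isTwoStepType_of_relation (hL : Module.finrank F L = 5) {x y z : L}
    (h : GeneratesModDerived F ![x, y, z]) (h2 : lowerCentral F L 2 = ⊥) {s t : F}
    (hr : ⁅x, y⁆ = s • ⁅x, z⁆ + t • ⁅y, z⁆) : IsTwoStepType F L := by
  -- The relation says precisely that x + tz and y - sz commute.
  refine isTwoStepType_of_generates hL (x := z) (y := x + t • z) (z := y - s • z)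
    (GeneratesModDerived.triple_iff.2 fun W hW hz hx hy => ?_) h2 ?_
  · refine GeneratesModDerived.triple_iff.1 h W hW ?_ ?_ hz
    · simpa using W.sub_mem hx (W.smul_mem t hz)
    · simpa using W.add_mem hy (W.smul_mem s hz)
  · simp only [add_lie, lie_sub, smul_lie, lie_smul, lie_self, hr, ← lie_skew y z, smul_zero]
    module

theorem isTwoStepType_of_finrank [Module.Finite F L] (hL : Module.finrank F L = 5)
    (h1 : Module.finrank F (lowerCentral F L 1) = 2) {x y z : L}
    (h : GeneratesModDerived F ![x, y, z]) (h2 : lowerCentral F L 2 = ⊥) : IsTwoStepType F L := by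
  let w : Fin 3 → lowerCentral F L 1 := ![⟨⁅x, y⁆, lie_mem_lowerCentral_one x y⟩,
    ⟨⁅x, z⁆, lie_mem_lowerCentral_one x z⟩, ⟨⁅y, z⁆, lie_mem_lowerCentral_one y z⟩]
  -- Three brackets in a plane are dependent; whichever coefficient is nonzero, its bracket is
  -- solved for and the generators are permuted to match.
  have hw : ¬ LinearIndependent F w := fun hw => by
    have := hw.fintype_card_le_finrank
    rw [h1, Fintype.card_fin] at this
    omega
  obtain ⟨g, hg, i, hi⟩ := Fintype.not_linearIndependent_iff.1 hw
  have hg' : g 0 • ⁅x, y⁆ + g 1 • ⁅x, z⁆ + g 2 • ⁅y, z⁆ = 0 := by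
    have := congrArg Subtype.val hg
    rwa [Fin.sum_univ_three] at this
  have key : ∀ {c : F} {u v : L}, c ≠ 0 → c • u = v → u = c⁻¹ • v := fun hc h => by
    rw [← h, smul_smul, inv_mul_cancel₀ hc, one_smul]
  fin_cases i
  · refine isTwoStepType_of_relation hL h h2 (s := (g 0)⁻¹ * -g 1) (t := (g 0)⁻¹ * -g 2) ?_
    rw [mul_smul, mul_smul, ← smul_add]
    refine key hi ?_
    rw [← sub_eq_zero, ← hg']
    module
  · refine isTwoStepType_of_relation hL (x := x) (y := z) (z := y)
      (GeneratesModDerived.triple_iff.2 fun W hW hx hz hy =>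
        GeneratesModDerived.triple_iff.1 h W hW hx hy hz) h2
      (s := (g 1)⁻¹ * -g 0) (t := (g 1)⁻¹ * g 2) ?_
    rw [mul_smul, mul_smul, ← smul_add]
    refine key hi ?_
    rw [← sub_eq_zero, ← hg', ← lie_skew z y]
    module
  · refine isTwoStepType_of_relation hL (x := y) (y := z) (z := x)
      (GeneratesModDerived.triple_iff.2 fun W hW hy hz hx =>
        GeneratesModDerived.triple_iff.1 h W hW hx hy hz) h2
      (s := (g 2)⁻¹ * g 0) (t := (g 2)⁻¹ * g 1) ?_
    rw [mul_smul, mul_smul, ← smul_add]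
    refine key hi ?_
    rw [← sub_eq_zero, ← hg', ← lie_skew y x, ← lie_skew z x]
    module

theorem lie_lie_mem_lowerCentral_three_of_mem_two {a b z : L} (haz : ⁅a, z⁆ ∈ lowerCentral F L 2)
    (hbz : ⁅b, z⁆ ∈ lowerCentral F L 2) : ⁅z, ⁅a, b⁆⁆ ∈ lowerCentral F L 3 := by
  rw [leibniz_lie z a b, ← lie_skew z a, ← lie_skew z b, neg_lie, lie_neg]
  exact Submodule.add_mem _ (Submodule.neg_mem _ (lie_mem_lowerCentral' haz b))
    (Submodule.neg_mem _ (lie_mem_lowerCentral a hbz))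

theorem GeneratesModDerived.triple_lowerCentral_two_le {a b z : L} {W : Submodule F L}
    (h : GeneratesModDerived F ![a, b, z]) (hW : lowerCentral F L 3 ≤ W)
    (haz : ⁅a, z⁆ ∈ lowerCentral F L 2) (hbz : ⁅b, z⁆ ∈ lowerCentral F L 2)
    (ha : ⁅a, ⁅a, b⁆⁆ ∈ W) (hb : ⁅b, ⁅a, b⁆⁆ ∈ W) : lowerCentral F L 2 ≤ W := by
  refine lowerCentral_succ_le_of_generates (n := 1) h (t := ![⁅a, b⁆]) (fun j => ?_)
    (fun W' h1 h2 => h.triple_lowerCentral_one_le h1 (h2 0) (h1 haz) (h1 hbz)) hW fun i j => ?_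
  · fin_cases j; exact lie_mem_lowerCentral_one a b
  · fin_cases j; fin_cases i
    · exact ha
    · exact hb
    · exact hW (lie_lie_mem_lowerCentral_three_of_mem_two haz hbz)

theorem isThreeStepType_of_generates (hL : Module.finrank F L = 5) {a b z : L} {ε : F}
    (h : GeneratesModDerived F ![a, b, z]) (h3 : lowerCentral F L 3 = ⊥) (haz : ⁅a, z⁆ = 0)
    (hb : ⁅b, ⁅a, b⁆⁆ = 0) (hbz : ⁅b, z⁆ = ε • ⁅a, ⁅a, b⁆⁆) : IsThreeStepType F L ε := by
  have haz' : ⁅a, z⁆ ∈ lowerCentral F L 2 := haz ▸ Submodule.zero_mem _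
  have hbz' : ⁅b, z⁆ ∈ lowerCentral F L 2 :=
    hbz ▸ Submodule.smul_mem _ _ (lie_lie_mem_lowerCentral_two _ _ _)
  obtain ⟨v, hv⟩ := exists_basis_of_spans hL ![a, b, ⁅a, b⁆, z, ⁅a, ⁅a, b⁆⁆] fun W hW => by
    have h2W := h.triple_lowerCentral_two_le (W := W) (by rw [h3]; exact bot_le) haz' hbz' (hW 4)
      (by rw [hb]; exact W.zero_mem)
    exact GeneratesModDerived.triple_iff.1 h W
      (h.triple_lowerCentral_one_le h2W (hW 2) (h2W haz') (h2W hbz')) (hW 0) (hW 1) (hW 3)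
  refine ⟨v, ?_⟩
  rw [hv]
  have k : ∀ x y z w : L, ⁅x, ⁅y, ⁅z, w⁆⁆⁆ = 0 := fun x y z w =>
    eq_zero_of_mem_lowerCentral h3 (lie_lie_lie_mem_lowerCentral_three x y z w)
  constructor
  · rfl
  · rfl
  · exact haz
  · exact k _ _ _ _
  · exact hb
  · exact hbz
  · exact k _ _ _ _
  · change ⁅⁅a, b⁆, z⁆ = 0
    rw [← lie_skew, neg_eq_zero]
    exact eq_zero_of_mem_lowerCentral h3 (lie_lie_mem_lowerCentral_three_of_mem_two haz' hbz')
  · exact k _ _ _ _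
  · exact k _ _ _ _

/-- Everything in γ₂ is a multiple of e = [a,[a,b]]. Correcting b by a multiple of a kills
[b,[a,b]], and correcting z by a multiple of [a,b] kills [a,z]. Only [b,z] = ν·e is left, and z can
be rescaled. -/
theorem isThreeStepType_of_lie_lie_ne_zero [Module.Finite F L] (hL : Module.finrank F L = 5)
    (h2 : Module.finrank F (lowerCentral F L 2) ≤ 1) {a b z : L}
    (h : GeneratesModDerived F ![a, b, z]) (h3 : lowerCentral F L 3 = ⊥)
    (haz : ⁅a, z⁆ ∈ lowerCentral F L 2) (hbz : ⁅b, z⁆ ∈ lowerCentral F L 2)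
    (he : ⁅a, ⁅a, b⁆⁆ ≠ 0) : IsThreeStepType F L 0 ∨ IsThreeStepType F L 1 := by
  have mult : ∀ x ∈ lowerCentral F L 2, ∃ k : F, x = k • ⁅a, ⁅a, b⁆⁆ := fun x hx => by
    obtain ⟨k, hk⟩ := Submodule.exists_sub_smul_mem (P := ⊥) (Q := lowerCentral F L 2) bot_le
      (by rw [finrank_bot]; omega) (lie_lie_mem_lowerCentral_two a a b) (by simpa using he) hx
    exact ⟨k, sub_eq_zero.1 ((Submodule.mem_bot F).1 hk)⟩
  obtain ⟨k, hk⟩ := mult _ (lie_lie_mem_lowerCentral_two b a b)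
  obtain ⟨μ, hμ⟩ := mult _ haz
  set b' := b - k • a with hb'
  set z' := z - μ • ⁅a, b⁆ with hz'
  have hab' : ⁅a, b'⁆ = ⁅a, b⁆ := by rw [hb', lie_sub, lie_smul, lie_self, smul_zero, sub_zero]
  have haz' : ⁅a, z'⁆ = 0 := by rw [hz', lie_sub, lie_smul, hμ, sub_self]
  have hbb' : ⁅b', ⁅a, b'⁆⁆ = 0 := by rw [hab', hb', sub_lie, smul_lie, hk, sub_self]
  obtain ⟨ν, hν⟩ := mult ⁅b', z'⁆ (by
    rw [hz', lie_sub, lie_smul, ← hab', hbb', smul_zero, sub_zero, hb', sub_lie, smul_lie]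
    exact Submodule.sub_mem _ hbz (Submodule.smul_mem _ _ haz))
  have h' : GeneratesModDerived F ![a, b', z'] :=
    GeneratesModDerived.triple_iff.2 fun W hW ha hb hz => by
      refine GeneratesModDerived.triple_iff.1 h W hW ha ?_ ?_
      · simpa [hb'] using W.add_mem hb (W.smul_mem k ha)
      · simpa [hz'] using W.add_mem hz (W.smul_mem μ (hW (lie_mem_lowerCentral_one a b)))
  by_cases hν0 : ν = 0
  · subst hν0
    exact Or.inl (isThreeStepType_of_generates hL h' h3 haz' hbb' (by rw [hab', hν]))
  · right
    refine isThreeStepType_of_generates hL (a := a) (b := b') (z := ν⁻¹ • z')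
      (GeneratesModDerived.triple_iff.2 fun W hW ha hb hz => ?_) h3
      (by rw [lie_smul, haz', smul_zero]) hbb' ?_
    · refine GeneratesModDerived.triple_iff.1 h' W hW ha hb ?_
      have := W.smul_mem ν hz
      rwa [smul_smul, mul_inv_cancel₀ hν0, one_smul] at this
    · rw [lie_smul, hν, smul_smul, inv_mul_cancel₀ hν0, hab']

theorem isThreeStepType_of_lie_notMem [LieRing.IsNilpotent L] [Module.Finite F L]
    (hL : Module.finrank F L = 5) (h1 : Module.finrank F (lowerCentral F L 1) = 2) {a b x : L}
    (h : GeneratesModDerived F ![a, b, x]) (h2 : lowerCentral F L 2 ≠ ⊥)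
    (hab : ⁅a, b⁆ ∉ lowerCentral F L 2) : IsThreeStepType F L 0 ∨ IsThreeStepType F L 1 := by
  have h1' : lowerCentral F L 1 ≠ ⊥ := fun e => by rw [e, finrank_bot] at h1; omega
  have r1 := finrank_lowerCentral_succ_lt h1'
  have r2 := finrank_lowerCentral_succ_lt h2
  simp only [Nat.reduceAdd] at r1 r2
  have h3 : lowerCentral F L 3 = ⊥ := Submodule.finrank_eq_zero.1 (by omega)
  have mult : ∀ y : L, y ∈ lowerCentral F L 1 → ∃ k : F, y - k • ⁅a, b⁆ ∈ lowerCentral F L 2 :=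
    fun y hy => Submodule.exists_sub_smul_mem (P := lowerCentral F L 2)
      (Q := lowerCentral F L 1) (lowerCentral_succ_le 1)
      (by omega) (lie_mem_lowerCentral_one a b) hab hy
  obtain ⟨s, hs⟩ := mult _ (lie_mem_lowerCentral_one a x)
  obtain ⟨t, ht⟩ := mult _ (lie_mem_lowerCentral_one b x)
  -- Chosen so that z commutes with both a and b modulo γ₂.
  set z := x - s • b + t • a with hz
  have haz : ⁅a, z⁆ ∈ lowerCentral F L 2 := by
    rw [hz, lie_add, lie_sub, lie_smul, lie_smul, lie_self, smul_zero, add_zero]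
    exact hs
  have hbz : ⁅b, z⁆ ∈ lowerCentral F L 2 := by
    rw [hz, lie_add, lie_sub, lie_smul, lie_smul, lie_self, smul_zero, sub_zero, ← lie_skew b a,
      smul_neg, ← sub_eq_add_neg]
    exact ht
  have h' : GeneratesModDerived F ![a, b, z] :=
    GeneratesModDerived.triple_iff.2 fun W hW ha hb hzW =>
      GeneratesModDerived.triple_iff.1 h W hW ha hb (by
        have := W.add_mem (W.sub_mem hzW (W.smul_mem t ha)) (W.smul_mem s hb)
        simpa [hz] using this)
  by_cases hea : ⁅a, ⁅a, b⁆⁆ = 0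
  · by_cases heb : ⁅b, ⁅a, b⁆⁆ = 0
    · refine absurd (eq_bot_iff.2 ?_) h2
      exact h'.triple_lowerCentral_two_le h3.le haz hbz (by simp [hea]) (by simp [heb])
    · refine isThreeStepType_of_lie_lie_ne_zero hL (by omega)
        (GeneratesModDerived.triple_iff.2 fun W hW hb ha hz =>
          GeneratesModDerived.triple_iff.1 h' W hW ha hb hz) h3 hbz haz ?_
      rwa [← lie_skew b a, lie_neg, neg_ne_zero]
  · exact isThreeStepType_of_lie_lie_ne_zero hL (by omega) h' h3 haz hbz hea

theorem classification_three_generators [LieRing.IsNilpotent L] [Module.Finite F L]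
    (hL : Module.finrank F L = 5) (h1 : Module.finrank F (lowerCentral F L 1) = 2)
    {a b c : L} (h : GeneratesModDerived F ![a, b, c]) :
    IsTwoStepType F L ∨ IsThreeStepType F L 0 ∨ IsThreeStepType F L 1 := by
  by_cases h2 : lowerCentral F L 2 = ⊥
  · exact Or.inl (isTwoStepType_of_finrank hL h1 h h2)
  right
  by_cases hab : ⁅a, b⁆ ∈ lowerCentral F L 2
  · by_cases hac : ⁅a, c⁆ ∈ lowerCentral F L 2
    · by_cases hbc : ⁅b, c⁆ ∈ lowerCentral F L 2
      · have := lowerCentral_eq_bot (h.triple_lowerCentral_one_le le_rfl hab hac hbc)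
        rw [this, finrank_bot] at h1
        omega
      · exact isThreeStepType_of_lie_notMem hL h1 (GeneratesModDerived.triple_iff.2
          fun W hW hb hc ha => GeneratesModDerived.triple_iff.1 h W hW ha hb hc) h2 hbc
    · exact isThreeStepType_of_lie_notMem hL h1 (GeneratesModDerived.triple_iff.2
        fun W hW ha hc hb => GeneratesModDerived.triple_iff.1 h W hW ha hb hc) h2 hac
  · exact isThreeStepType_of_lie_notMem hL h1 h h2 hab

end ClassificationThree

/-! ### Classification with four generators. -/

section ClassificationFour

variable {F L : Type*} [Field F] [LieRing L] [LieAlgebra F L]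

theorem GeneratesModDerived.quadruple_iff {a b c d : L} : GeneratesModDerived F ![a, b, c, d] ↔
    ∀ W : Submodule F L, lowerCentral F L 1 ≤ W → a ∈ W → b ∈ W → c ∈ W → d ∈ W → W = ⊤ := by
  simp [GeneratesModDerived, Fin.forall_fin_succ]

theorem isHeisenbergType_of_generates (hL : Module.finrank F L = 5) {a b u v : L} {ε : F}
    (h : GeneratesModDerived F ![a, b, u, v]) (h2 : lowerCentral F L 2 = ⊥) (hau : ⁅a, u⁆ = 0)
    (hav : ⁅a, v⁆ = 0) (hbu : ⁅b, u⁆ = 0) (hbv : ⁅b, v⁆ = 0) (huv : ⁅u, v⁆ = ε • ⁅a, b⁆) :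
    IsHeisenbergType F L ε := by
  obtain ⟨w, hw⟩ := exists_basis_of_spans hL ![a, b, u, v, ⁅a, b⁆] fun W hW =>
    GeneratesModDerived.quadruple_iff.1 h W (lowerCentral_one_le_of_generates h
      (by rw [h2]; exact bot_le) fun i j hij => by
        fin_cases i <;> fin_cases j <;> first | exact absurd hij (by decide) | skip
        · exact hW 4
        · exact hau ▸ W.zero_mem
        · exact hav ▸ W.zero_mem
        · exact hbu ▸ W.zero_mem
        · exact hbv ▸ W.zero_mem
        · exact huv ▸ W.smul_mem ε (hW 4)) (hW 0) (hW 1) (hW 2) (hW 3)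
  refine ⟨w, ?_⟩
  rw [hw]
  have k : ∀ x y z : L, ⁅x, ⁅y, z⁆⁆ = 0 := fun x y z =>
    eq_zero_of_mem_lowerCentral h2 (lie_lie_mem_lowerCentral_two x y z)
  constructor
  · rfl
  · exact hau
  · exact hav
  · exact k _ _ _
  · exact hbu
  · exact hbv
  · exact k _ _ _
  · exact huv
  · exact k _ _ _
  · exact k _ _ _

/-- The bracket is an alternating form with values in a line. The plane of a and b is hyperbolic and
splits off; on its orthogonal complement the form is zero or can be scaled to one. -/
theorem isHeisenbergType_of_lie_ne_zero [LieRing.IsNilpotent L] [Module.Finite F L]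
    (hL : Module.finrank F L = 5) (h1 : Module.finrank F (lowerCentral F L 1) = 1) {a b x y : L}
    (h : GeneratesModDerived F ![a, b, x, y]) (hab : ⁅a, b⁆ ≠ 0) :
    IsHeisenbergType F L 0 ∨ IsHeisenbergType F L 1 := by
  have h1' : lowerCentral F L 1 ≠ ⊥ := fun e => by rw [e, finrank_bot] at h1; omega
  have r1 := finrank_lowerCentral_succ_lt h1'
  simp only [Nat.reduceAdd] at r1
  have h2 : lowerCentral F L 2 = ⊥ := Submodule.finrank_eq_zero.1 (by omega)
  have mult : ∀ x y : L, ∃ k : F, ⁅x, y⁆ = k • ⁅a, b⁆ := fun x y => by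
    obtain ⟨k, hk⟩ := Submodule.exists_sub_smul_mem (P := ⊥) (Q := lowerCentral F L 1) bot_le
      (by rw [finrank_bot]; omega) (lie_mem_lowerCentral_one a b) (by simpa using hab)
      (lie_mem_lowerCentral_one x y)
    exact ⟨k, sub_eq_zero.1 ((Submodule.mem_bot F).1 hk)⟩
  have orth : ∀ x : L, ∃ p q : F, ⁅a, x - p • b + q • a⁆ = 0 ∧ ⁅b, x - p • b + q • a⁆ = 0 :=
    fun x => by
      obtain ⟨p, hp⟩ := mult a x
      obtain ⟨q, hq⟩ := mult b x
      refine ⟨p, q, ?_, ?_⟩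
      · rw [lie_add, lie_sub, lie_smul, lie_smul, lie_self, hp, smul_zero, add_zero, sub_self]
      · rw [lie_add, lie_sub, lie_smul, lie_smul, lie_self, hq, smul_zero, sub_zero,
          ← lie_skew b a, smul_neg, add_neg_cancel]
  obtain ⟨p, q, hau, hbu⟩ := orth x
  obtain ⟨p', q', hav, hbv⟩ := orth y
  set u := x - p • b + q • a with hu
  set v := y - p' • b + q' • a with hv
  have h' : GeneratesModDerived F ![a, b, u, v] :=
    GeneratesModDerived.quadruple_iff.2 fun W hW ha hb huW hvW => by
      refine GeneratesModDerived.quadruple_iff.1 h W hW ha hb ?_ ?_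
      · simpa [hu] using W.add_mem (W.sub_mem huW (W.smul_mem q ha)) (W.smul_mem p hb)
      · simpa [hv] using W.add_mem (W.sub_mem hvW (W.smul_mem q' ha)) (W.smul_mem p' hb)
  obtain ⟨ν, hν⟩ := mult u v
  by_cases hν0 : ν = 0
  · subst hν0
    exact Or.inl (isHeisenbergType_of_generates hL h' h2 hau hav hbu hbv hν)
  · right
    refine isHeisenbergType_of_generates hL (a := a) (b := b) (u := u) (v := ν⁻¹ • v)
      (GeneratesModDerived.quadruple_iff.2 fun W hW ha hb hu hv => ?_) h2 hau
      (by rw [lie_smul, hav, smul_zero]) hbu (by rw [lie_smul, hbv, smul_zero]) ?_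
    · refine GeneratesModDerived.quadruple_iff.1 h' W hW ha hb hu ?_
      have := W.smul_mem ν hv
      rwa [smul_smul, mul_inv_cancel₀ hν0, one_smul] at this
    · rw [lie_smul, hν, smul_smul, inv_mul_cancel₀ hν0]

theorem classification_four_generators [LieRing.IsNilpotent L] [Module.Finite F L]
    (hL : Module.finrank F L = 5) (h1 : Module.finrank F (lowerCentral F L 1) = 1)
    {a : Fin 4 → L} (h : GeneratesModDerived F a) :
    IsHeisenbergType F L 0 ∨ IsHeisenbergType F L 1 := by
  have hperm : ∀ σ : Equiv.Perm (Fin 4),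
      GeneratesModDerived F ![a (σ 0), a (σ 1), a (σ 2), a (σ 3)] := fun σ W hW hσ =>
    h W hW fun i => by
      obtain ⟨j, rfl⟩ := σ.surjective i
      have := hσ j
      fin_cases j <;> exact this
  obtain ⟨i, j, hij, hne⟩ : ∃ i j, i ≠ j ∧ ⁅a i, a j⁆ ≠ 0 := by
    by_contra! hcon
    have h1' : lowerCentral F L 1 = ⊥ := lowerCentral_eq_bot <|
      lowerCentral_one_le_of_generates h le_rfl fun i j hij => by
        rw [hcon i j hij.ne]; exact Submodule.zero_mem _
    rw [h1', finrank_bot] at h1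
    omega
  obtain ⟨σ, rfl, rfl⟩ : ∃ σ : Equiv.Perm (Fin 4), σ 0 = i ∧ σ 1 = j := by
    clear hne; revert i j; decide
  exact isHeisenbergType_of_lie_ne_zero hL h1 (hperm σ) hne

end ClassificationFour

/-! ### The full classification and the conclusion. -/

theorem classification {F L : Type*} [Field F] [LieRing L] [LieAlgebra F L]
    [LieRing.IsNilpotent L] (hL : Module.finrank F L = 5) :
    (Module.finrank F (L ⧸ derivedSubmodule F L) = 5 ∧ ∀ x y : L, ⁅x, y⁆ = 0) ∨
    (Module.finrank F (L ⧸ derivedSubmodule F L) = 4 ∧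
      (IsHeisenbergType F L 0 ∨ IsHeisenbergType F L 1)) ∨
    (Module.finrank F (L ⧸ derivedSubmodule F L) = 3 ∧
      (IsTwoStepType F L ∨ IsThreeStepType F L 0 ∨ IsThreeStepType F L 1)) ∨
    (Module.finrank F (L ⧸ derivedSubmodule F L) = 2 ∧
      (IsFreeThreeStepType F L ∨ IsFiliformType F L 0 ∨ IsFiliformType F L 1)) := by
  have : Module.Finite F L := Module.finite_of_finrank_pos (by omega)
  have hsum := Submodule.finrank_quotient_add_finrank (derivedSubmodule F L)
  obtain ⟨d, hd⟩ : ∃ d, Module.finrank F (L ⧸ derivedSubmodule F L) = d := ⟨_, rfl⟩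
  rw [hd, hL, ← lowerCentral_one] at hsum
  obtain ⟨a, ha⟩ := exists_generatesModDerived hd
  rw [hd]
  -- With at most one generator there is no pair to bracket, so the derived algebra vanishes and the
  -- dimension would be at most one.
  have hd2 : 2 ≤ d := by
    by_contra! hlt
    have hbot : lowerCentral F L 1 = ⊥ := lowerCentral_eq_bot <|
      lowerCentral_one_le_of_generates ha le_rfl fun i j hij => by omega
    rw [hbot, finrank_bot] at hsum
    omega
  have hd5 : d ≤ 5 := by omega
  interval_cases d
  · refine Or.inr (Or.inr (Or.inr ⟨rfl, ?_⟩))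
    refine classification_two_generators hL (by omega) (a := a 0) (b := a 1) ?_
    exact GeneratesModDerived.pair_iff.2 fun W hW h0 h1 =>
      ha W hW (by simpa [Fin.forall_fin_two] using ⟨h0, h1⟩)
  · refine Or.inr (Or.inr (Or.inl ⟨rfl, ?_⟩))
    refine classification_three_generators hL (by omega) (a := a 0) (b := a 1) (c := a 2) ?_
    exact GeneratesModDerived.triple_iff.2 fun W hW h0 h1 h2 =>
      ha W hW (by simpa [Fin.forall_fin_succ] using ⟨h0, h1, h2⟩)
  · exact Or.inr (Or.inl ⟨rfl, classification_four_generators hL (by omega) ha⟩)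
  · refine Or.inl ⟨rfl, fun x y => ?_⟩
    have hbot : lowerCentral F L 1 = ⊥ := Submodule.finrank_eq_zero.1 (by omega)
    exact eq_zero_of_mem_lowerCentral hbot (lie_mem_lowerCentral_one x y)

open UniversalEnvelopingAlgebra in
theorem lieEquiv_or_of_algEquiv {F L H : Type*} [Field F] [LieRing L] [LieAlgebra F L]
    [LieRing.IsNilpotent L] [LieRing H] [LieAlgebra F H] [LieRing.IsNilpotent H]
    (hL : Module.finrank F L = 5) (hH : Module.finrank F H = 5)
    (φ : UniversalEnvelopingAlgebra F L ≃ₐ[F] UniversalEnvelopingAlgebra F H) :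
    Nonempty (L ≃ₗ⁅F⁆ H) ∨ (CharP F 2 ∧
      ((IsThreeStepType F L 0 ∧ IsThreeStepType F H 1) ∨
       (IsThreeStepType F L 1 ∧ IsThreeStepType F H 0) ∨
       (IsFiliformType F L 1 ∧ IsFiliformType F H 0) ∨
       (IsFiliformType F L 0 ∧ IsFiliformType F H 1))) := by
  have : Module.Finite F L := Module.finite_of_finrank_pos (by omega)
  have : Module.Finite F H := Module.finite_of_finrank_pos (by omega)
  obtain ⟨ψ, hψ⟩ := exists_augmented_equiv φ
  have hψ' : ∀ u, augmentation F L (ψ.symm u) = augmentation F H u := fun u => by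
    rw [← hψ, ψ.apply_symm_apply]
  have hd : Module.finrank F (L ⧸ derivedSubmodule F L) =
      Module.finrank F (H ⧸ derivedSubmodule F H) :=
    le_antisymm (finrank_quotient_derivedSubmodule_le hψ')
      (finrank_quotient_derivedSubmodule_le hψ)
  have char2 : (2 : F) = 0 → CharP F 2 := CharTwo.of_one_ne_zero_of_two_eq_zero one_ne_zero
  rcases classification hL with ⟨d, h⟩ | ⟨d, h⟩ | ⟨d, h⟩ | ⟨d, h⟩ <;>
  rcases classification hH with ⟨d', h'⟩ | ⟨d', h'⟩ | ⟨d', h'⟩ | ⟨d', h'⟩ <;>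
  -- Types with different numbers of generators are excluded by `hd`.
  first | (exfalso; omega) | skip
  · exact Or.inl (nonempty_lieEquiv_of_abelian
      (LinearEquiv.ofFinrankEq L H (hL.trans hH.symm)) h h')
  · rcases h with h | h <;> rcases h' with h' | h'
    · exact Or.inl (h.lieEquiv h')
    · exact (not_heisenbergType hψ h h').elim
    · exact (not_heisenbergType hψ' h' h).elim
    · exact Or.inl (h.lieEquiv h')
  · rcases h with h | h | h <;> rcases h' with h' | h' | h'
    · exact Or.inl (h.lieEquiv h')
    · exact (not_twoStepType_threeStepType hψ h h').elim
    · exact (not_twoStepType_threeStepType hψ h h').elim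
    · exact (not_twoStepType_threeStepType hψ' h' h).elim
    · exact Or.inl (h.lieEquiv h')
    · by_cases h2 : (2 : F) = 0
      · exact Or.inr ⟨char2 h2, Or.inl ⟨h, h'⟩⟩
      · exact (not_threeStepType h2 hψ h h').elim
    · exact (not_twoStepType_threeStepType hψ' h' h).elim
    · by_cases h2 : (2 : F) = 0
      · exact Or.inr ⟨char2 h2, Or.inr (Or.inl ⟨h, h'⟩)⟩
      · exact (not_threeStepType h2 hψ' h' h).elim
    · exact Or.inl (h.lieEquiv h')
  · rcases h with h | h | h <;> rcases h' with h' | h' | h'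
    · exact Or.inl (h.lieEquiv h')
    · exact (not_freeThreeStepType_filiformType hψ h h').elim
    · exact (not_freeThreeStepType_filiformType hψ h h').elim
    · exact (not_freeThreeStepType_filiformType hψ' h' h).elim
    · exact Or.inl (h.lieEquiv h')
    · by_cases h2 : (2 : F) = 0
      · exact Or.inr ⟨char2 h2, Or.inr (Or.inr (Or.inr ⟨h, h'⟩))⟩
      · exact (not_filiformType h2 hψ h h').elim
    · exact (not_freeThreeStepType_filiformType hψ' h' h).elim
    · by_cases h2 : (2 : F) = 0
      · exact Or.inr ⟨char2 h2, Or.inr (Or.inr (Or.inl ⟨h, h'⟩))⟩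
      · exact (not_filiformType h2 hψ' h' h).elim
    · exact Or.inl (h.lieEquiv h')

open UniversalEnvelopingAlgebra in
theorem mainTheorem3 {F : Type*} [Field F]
    {L : Type*} [LieRing L] [LieAlgebra F L] [LieRing.IsNilpotent L]
    {H : Type*} [LieRing H] [LieAlgebra F H] [LieRing.IsNilpotent H]
    (hL : Module.finrank F L = 5) (hH : Module.finrank F H = 5) :
    Nonempty (UniversalEnvelopingAlgebra F L ≃ₐ[F] UniversalEnvelopingAlgebra F H) ↔
      Nonempty (L ≃ₗ⁅F⁆ H) ∨
      (CharP F 2 ∧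
        ((Nonempty (L ≃ₗ⁅F⁆ DeGraafLie .L53 F) ∧ Nonempty (H ≃ₗ⁅F⁆ DeGraafLie .L55 F)) ∨
         (Nonempty (L ≃ₗ⁅F⁆ DeGraafLie .L55 F) ∧ Nonempty (H ≃ₗ⁅F⁆ DeGraafLie .L53 F)) ∨
         (Nonempty (L ≃ₗ⁅F⁆ DeGraafLie .L56 F) ∧ Nonempty (H ≃ₗ⁅F⁆ DeGraafLie .L57 F)) ∨
         (Nonempty (L ≃ₗ⁅F⁆ DeGraafLie .L57 F) ∧ Nonempty (H ≃ₗ⁅F⁆ DeGraafLie .L56 F)))) := by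
  constructor
  · rintro ⟨φ⟩
    refine (lieEquiv_or_of_algEquiv hL hH φ).imp_right fun ⟨h2, h⟩ => ⟨h2, ?_⟩
    rcases h with ⟨h, h'⟩ | ⟨h, h'⟩ | ⟨h, h'⟩ | ⟨h, h'⟩
    · exact Or.inl ⟨h.lieEquiv (isThreeStepType_L53 F), h'.lieEquiv (isThreeStepType_L55 F)⟩
    · exact Or.inr (Or.inl
        ⟨h.lieEquiv (isThreeStepType_L55 F), h'.lieEquiv (isThreeStepType_L53 F)⟩)
    · exact Or.inr (Or.inr (Or.inl
        ⟨h.lieEquiv (isFiliformType_L56 F), h'.lieEquiv (isFiliformType_L57 F)⟩))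
    · exact Or.inr (Or.inr (Or.inr
        ⟨h.lieEquiv (isFiliformType_L57 F), h'.lieEquiv (isFiliformType_L56 F)⟩))
  · rintro (⟨⟨e⟩⟩ | ⟨h2, h⟩)
    · exact nonempty_algEquiv_of_lieEquiv e
    · obtain ⟨α⟩ := nonempty_algEquiv_threeStepType (isThreeStepType_L53 F) (isThreeStepType_L55 F)
      obtain ⟨β⟩ := nonempty_algEquiv_filiformType (isFiliformType_L57 F) (isFiliformType_L56 F)
      have key : ∀ {k k' : DeGraafName}, Nonempty (L ≃ₗ⁅F⁆ DeGraafLie k F) →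
          Nonempty (H ≃ₗ⁅F⁆ DeGraafLie k' F) →
          (UniversalEnvelopingAlgebra F (DeGraafLie k F) ≃ₐ[F]
            UniversalEnvelopingAlgebra F (DeGraafLie k' F)) →
          Nonempty (UniversalEnvelopingAlgebra F L ≃ₐ[F] UniversalEnvelopingAlgebra F H) := by
        rintro k k' ⟨e⟩ ⟨e'⟩ γ
        obtain ⟨f⟩ := nonempty_algEquiv_of_lieEquiv e
        obtain ⟨f'⟩ := nonempty_algEquiv_of_lieEquiv e'
        exact ⟨(f.trans γ).trans f'.symm⟩
      rcases h with ⟨h, h'⟩ | ⟨h, h'⟩ | ⟨h, h'⟩ | ⟨h, h'⟩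
      · exact key h h' α
      · exact key h h' α.symm
      · exact key h h' β.symm
      · exact key h h' β
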